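/- **Optimality of $k$NN on location-slope data.** Let $T>0$ and let $\mathfrak G_0,\mathfrak G_1$ be two real stochastic processes on $[0,T]$, defined on a common probability space, whose paths are almost surely continuous and piecewise smooth (smooth off a finite set). Let $\ell\ge 1$, let $t_1<\dots<t_\ell$ be points of $[0,T]$, and let $F_c$ be the law of $(\mathfrak G_c(t_1),\dots,\mathfrak G_c(t_\ell))$ on $\mathbb R^\ell$, $c=0,1$. Let $\pi_0,\pi_1\ge 0$, $\pi_0+\pi_1=1$, be the prior probabilities of the two classes. The risk of a rule $g:\mathbb R^\ell\to\{0,1\}$ is $\pi_0F_0(g=1)+\pi_1F_1(g=0)$, and the Bayes risk is the infimum of the risk over all measurable rules. For $v\in\mathbb R^\ell$ let $x_v:[0,T]\to\mathbb R$ be the linear interpolation of the points $(t_j,v_j)$, continued by the constants $v_1$ on $[0,t_1]$ and $v_\ell$ on $[t_\ell,T]$. For integers $L,S\ge 0$, $L+S\ge1$, the location-slope (LS) transform is $$\phi_{L,S}(v)=\Bigl[\int_0^{T/L}x_v\,dt,\dots,\int_{T(L-1)/L}^{T}x_v\,dt,\ \int_0^{T/S}x_v'\,dt,\dots,\int_{T(S-1)/S}^{T}x_v'\,dt\Bigr]\in\mathbb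 R^{L+S}$$ (the first or the second group of coordinates is absent if $L=0$ or $S=0$). Given training points $y^0_1,\dots,y^0_m$ of class $0$ and $y^1_1,\dots,y^1_n$ of class $1$ in the Euclidean space $\mathbb R^{L+S}$, the $k$NN classifier takes the smallest closed ball around the point $y$ that contains at least $k$ of the $m+n$ training points, and assigns $y$ to class $1$ if this ball contains more training points of class $1$ than of class $0$, and to class $0$ otherwise. Let $V_1,V_2,\dots\sim F_0$ and $W_1,W_2,\dots\sim F_1$ be independent random vectors. For $N\in\mathbb N$ let the training sample consist of $V_1,\dots,V_{m_N}$ (class $0$) and $W_1,\dots,W_{n_N}$ (class $1$), where $m_N+n_N\to\infty$ and $n_N/(m_N+n_N)\to\pi_1$, and let $k_N\to\infty$ with $k_N/(m_N+n_N)\to 0$. Let $L^*\ge1$ and $S^*\ge 0$ be integers with $L^*>T/\min_{1\le i<\ell}(t_{i+1}-t_i)$ (no condition but $L^*\ge 1$ if $\ell=1$); for instance, $S^*=0$. Then the $k_N$NN classifier applied to the LS-transformed data, that is, the rule on $\mathbb R^\ell$ that assigns to $v$ the class that the $k_N$NN classifier, trained with $\phi_{L^*,S^*}(V_i)$, $i\le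 m_N$, and $\phi_{L^*,S^*}(W_j)$, $j\le n_N$, gives to $\phi_{L^*,S^*}(v)$, is Bayes optimal relative to $F_0,F_1$: its risk (a random variable depending on the training sample) converges in probability to the Bayes risk as $N\to\infty$. -/

import Mathlib

open MeasureTheory ProbabilityTheory Filter Topology

namespace LSkNN

noncomputable section

/-- The space of paths: real functions on `[0, T]` which are continuous on `[0, T]` and smooth
off a finite set of points. -/
def IsPath (T : ℝ) (f : ℝ → ℝ) : Prop :=
  ContinuousOn f (Set.Icc 0 T) ∧
    ∃ D : Finset ℝ, ContDiffOn ℝ (⊤ : ℕ∞) f (Set.Icc 0 T \ (D : Set ℝ))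

/-- The joint law of the values of the process `X` at the points `t j`. -/
def marginal {Ω : Type*} [MeasurableSpace Ω] (P : Measure Ω) (X : ℝ → Ω → ℝ)
    {ℓ : ℕ} (t : Fin ℓ → ℝ) : Measure (Fin ℓ → ℝ) :=
  P.map (fun ω j => X (t j) ω)

/-- Linear interpolation of the points `(t j, v j)`, `j = 0, …, p` (for increasing `t`), continued
by the constant `v 0` to the left of `t 0` and by the constant `v p` to the right of `t p`.
It is written as a sum of ramps: the `j`-th summand increases linearly from `0` to
`v (j + 1) - v j` on `[t j, t (j + 1)]` and is constant on both sides of this interval. -/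
def linInterp {p : ℕ} (t v : Fin (p + 1) → ℝ) (s : ℝ) : ℝ :=
  v 0 + ∑ j : Fin p, (v j.succ - v j.castSucc) *
    max 0 (min 1 ((s - t j.castSucc) / (t j.succ - t j.castSucc)))

/-- The interpolating function takes the prescribed values at the points `t i`. -/
theorem linInterp_apply {p : ℕ} (t v : Fin (p + 1) → ℝ) (ht : StrictMono t) (i : Fin (p + 1)) :
    linInterp t v (t i) = v i := by
  have key : ∀ j : Fin p, (v j.succ - v j.castSucc) *
      max 0 (min 1 ((t i - t j.castSucc) / (t j.succ - t j.castSucc))) =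
        if (j : ℕ) < (i : ℕ) then v j.succ - v j.castSucc else 0 := by
    intro j
    have hg : 0 < t j.succ - t j.castSucc := sub_pos.2 (ht (Fin.castSucc_lt_succ))
    split_ifs with h
    · have h3 : t j.succ ≤ t i := ht.monotone (Fin.le_def.2 (by simpa using h))
      have h4 : 1 ≤ (t i - t j.castSucc) / (t j.succ - t j.castSucc) := by
        rw [le_div_iff₀ hg]; linarith
      rw [min_eq_left h4, max_eq_right zero_le_one, mul_one]
    · have h3 : t i ≤ t j.castSucc := ht.monotone (Fin.le_def.2 (by simpa using h))
      rw [max_eq_left, mul_zero]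
      exact (min_le_right _ _).trans (div_nonpos_of_nonpos_of_nonneg (by linarith) hg.le)
  unfold linInterp
  rw [Finset.sum_congr rfl (fun j _ => key j)]
  clear key
  induction i using Fin.induction with
  | zero => simp
  | succ i ih =>
    have h5 : ∀ j : Fin p,
        (if (j : ℕ) < (i.succ : ℕ) then v j.succ - v j.castSucc else 0) =
          (if (j : ℕ) < (i.castSucc : ℕ) then v j.succ - v j.castSucc else 0) +
            (if j = i then v j.succ - v j.castSucc else 0) := by
      intro j
      rw [Fin.val_succ, Fin.val_castSucc]
      rcases lt_trichotomy (j : ℕ) (i : ℕ) with h | h | h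
      · have hne : j ≠ i := fun e => h.ne (congrArg Fin.val e)
        rw [if_pos (by omega), if_pos h, if_neg hne, add_zero]
      · have he : j = i := Fin.ext h
        rw [if_pos (by omega), if_neg (by omega), if_pos he, zero_add]
      · have hne : j ≠ i := fun e => h.ne' (congrArg Fin.val e)
        rw [if_neg (by omega), if_neg (by omega), if_neg hne, add_zero]
    rw [Finset.sum_congr rfl (fun j _ => h5 j), Finset.sum_add_distrib, ← add_assoc, ih]
    simp

/-- The location-slope transform: the vector of values `v` at the points `t` is interpolated
linearly; the interpolating function is integrated over the `L` subintervals of `[0, T]` of length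
`T / L`, its derivative is integrated over the `S` subintervals of length `T / S`. -/
def lsTransform (T : ℝ) {p : ℕ} (t : Fin (p + 1) → ℝ) (L S : ℕ) (v : Fin (p + 1) → ℝ) :
    EuclideanSpace ℝ (Fin L ⊕ Fin S) :=
  WithLp.toLp 2 (Sum.elim
    (fun i : Fin L => ∫ s in (T * (i : ℝ) / L)..(T * ((i : ℝ) + 1) / L), linInterp t v s)
    (fun i : Fin S => ∫ s in (T * (i : ℝ) / S)..(T * ((i : ℝ) + 1) / S), deriv (linInterp t v) s))

/-- The number of the points `y i` in the closed ball with centre `x` and radius `r`. -/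
def ballCount {E : Type*} [PseudoMetricSpace E] {m : ℕ} (y : Fin m → E) (x : E) (r : ℝ) : ℕ :=
  Nat.card {i : Fin m // dist (y i) x ≤ r}

/-- The radius of the smallest closed ball with centre `x` that contains (at least) `k` of the
training observations of the two classes. -/
def knnRadius {E : Type*} [PseudoMetricSpace E] {m n : ℕ} (y₀ : Fin m → E) (y₁ : Fin n → E)
    (k : ℕ) (x : E) : ℝ :=
  sInf {r : ℝ | 0 ≤ r ∧ k ≤ ballCount y₀ x r + ballCount y₁ x r}

open scoped Classical in
/-- The `k`-nearest-neighbour rule: `x` is put into class `1` if the smallest ball around `x` with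
`k` training observations has more observations of class `1` than of class `0`, and into class `0`
otherwise. -/
def knnClassifier {E : Type*} [PseudoMetricSpace E] {m n : ℕ} (y₀ : Fin m → E) (y₁ : Fin n → E)
    (k : ℕ) (x : E) : Fin 2 :=
  if ballCount y₀ x (knnRadius y₀ y₁ k x) < ballCount y₁ x (knnRadius y₀ y₁ k x) then 1 else 0

/-- The risk (probability of misclassification) of the decision rule `g` for two classes with laws
`F 0`, `F 1` and prior probabilities `π 0`, `π 1`. -/
def risk {X : Type*} [MeasurableSpace X] (π : Fin 2 → ℝ) (F : Fin 2 → Measure X)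
    (g : X → Fin 2) : ℝ :=
  π 0 * (F 0).real {x | g x = 1} + π 1 * (F 1).real {x | g x = 0}

/-- The Bayes risk: the infimum of the risk over all measurable decision rules. -/
def bayesRisk {X : Type*} [MeasurableSpace X] (π : Fin 2 → ℝ) (F : Fin 2 → Measure X) : ℝ :=
  ⨅ g : {g : X → Fin 2 // Measurable g}, risk π F g.1

/-- A sequence of (sample dependent) decision rules is Bayes optimal if its risk converges in
probability to the Bayes risk. -/
def BayesOptimal {Ω X : Type*} [MeasurableSpace Ω] [MeasurableSpace X] (P : Measure Ω)
    (π : Fin 2 → ℝ) (F : Fin 2 → Measure X) (g : ℕ → Ω → X → Fin 2) : Prop :=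
  TendstoInMeasure P (fun N ω => risk π F (g N ω)) atTop (fun _ => bayesRisk π F)

end

end LSkNN

/-! Two facts combine: the LS transform loses no information, and $k$NN is universally consistent in
Euclidean space.

Lossless transform. If all location integrals of the interpolant of $v-v'$ vanish, the interpolant
has a zero in each of the $L$ cells of length $T/L$. The gaps between knots exceed the cell length,
and a piecewise linear function with so few knots cannot have all these zeros unless it vanishes
(`eq_zero_of_zeros_in_cells`). So the transform is injective and measurable between standard Borel
spaces, hence a measurable embedding, and it preserves risks and the Bayes risk (`risk_comp`,
`bayesRisk_map`).

Consistency. Let $\mu_c$ be the class laws, $\sigma=\mu_0+\mu_1$ and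
$h=\pi_1\,d\mu_1/d\sigma-\pi_0\,d\mu_0/d\sigma$. The excess risk of a rule is at most the integral
of $|h|$ over the set where it disagrees with the Bayes rule $\{h>0\}$ (`exists_bayes_rule`). By
Besicovitch differentiation, at almost every $x$ with $h(x)\ne0$ the class favoured by $h$ has the
larger expected count in all small balls around $x$. Chebyshev bounds, with room for ties, turn this
into a majority among the neighbours with probability tending to one (`measure_not_majority_le`).
Dominated convergence, Tonelli and Markov then give convergence in probability
(`bayesOptimal_knnClassifier`). -/

namespace LSkNN

/-! ### Concentration of the vote, for real samples with atoms allowed. -/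

/-- One-sided Chebyshev inequality for a finite sum of independent random variables. -/
theorem measure_sum_le_sub_le {Ω ι : Type*} [MeasurableSpace Ω] [Fintype ι] {P : Measure Ω}
    [IsProbabilityMeasure P] {Y : ι → Ω → ℝ} (hind : iIndepFun Y P) (hY : ∀ i, MemLp (Y i) 2 P)
    {E W a : ℝ} (ha : 0 < a) (hE : E ≤ ∑ i, ∫ ω, Y i ω ∂P)
    (hW : ∑ i, ∫ ω, (Y i ω) ^ 2 ∂P ≤ W) :
    P {ω | ∑ i, Y i ω ≤ E - a} ≤ ENNReal.ofReal (W / a ^ 2) := by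
  have hS : MemLp (∑ i, Y i) 2 P := memLp_finsetSum' _ fun i _ => hY i
  have hmean : ∫ ω, (∑ i, Y i) ω ∂P = ∑ i, ∫ ω, Y i ω ∂P := by
    simp only [Finset.sum_apply]
    exact integral_finsetSum _ fun i _ => (hY i).integrable (by norm_num)
  have hvar : Var[∑ i, Y i; P] ≤ W := by
    rw [IndepFun.variance_sum (fun i _ => hY i) fun i _ j _ hij => hind.indepFun hij]
    refine le_trans (Finset.sum_le_sum fun i _ => ?_) hW
    exact variance_le_expectation_sq (hY i).aestronglyMeasurable
  calc P {ω | ∑ i, Y i ω ≤ E - a}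
      ≤ P {ω | a ≤ |(∑ i, Y i) ω - ∫ ω, (∑ i, Y i) ω ∂P|} := by
        refine measure_mono fun ω hω => ?_
        rw [Set.mem_ofPred_eq] at hω ⊢
        rw [hmean, Finset.sum_apply, abs_sub_comm]
        exact le_trans (by linarith) (le_abs_self _)
    _ ≤ ENNReal.ofReal (Var[∑ i, Y i; P] / a ^ 2) := meas_ge_le_variance_div_sq hS ha
    _ ≤ ENNReal.ofReal (W / a ^ 2) := by gcongr

open scoped Classical in
/-- Deviation inequality for signed counts of sample points of two classes. -/
theorem measure_signed_count_le {Ω : Type*} [MeasurableSpace Ω] {P : Measure Ω}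
    [IsProbabilityMeasure P] {D : Fin 2 → ℕ → Ω → ℝ} (hD : ∀ c i, Measurable (D c i))
    (hind : iIndepFun (fun ci : Fin 2 × ℕ => D ci.1 ci.2) P) {ν : Fin 2 → Measure ℝ}
    (hlaw : ∀ c i, P.map (D c i) = ν c) (s : Fin 2 → ℕ) {A : Fin 2 → Set ℝ}
    (hA : ∀ c, MeasurableSet (A c)) {e : Fin 2 → ℝ} (he : ∀ c, e c ^ 2 = 1)
    {E W a : ℝ} (ha : 0 < a) (hE : E ≤ ∑ c, e c * (s c * (ν c).real (A c)))
    (hW : ∑ c, s c * (ν c).real (A c) ≤ W) :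
    P {ω | ∑ c, e c * (Nat.card {i : Fin (s c) // D c i ω ∈ A c} : ℝ) ≤ E - a} ≤
      ENNReal.ofReal (W / a ^ 2) := by
  -- Since the signs square to one, the second moments of these signed indicators add up to the
  -- expected total count, whatever the signs. The sign $-1$ turns lower deviations into upper ones.
  let Y : (Σ c : Fin 2, Fin (s c)) → Ω → ℝ := fun ci =>
    (fun x => e ci.1 * (A ci.1).indicator 1 x) ∘ D ci.1 ci.2
  have hmeas : ∀ c, Measurable (fun x => e c * (A c).indicator (1 : ℝ → ℝ) x) := fun c =>
    (measurable_one.indicator (hA c)).const_mul _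
  have hY : iIndepFun Y P := by
    have hinj : Function.Injective
        (fun ci : (Σ c : Fin 2, Fin (s c)) => ((ci.1, (ci.2 : ℕ)) : Fin 2 × ℕ)) := by
      rintro ⟨c, i⟩ ⟨c', i'⟩ h
      simp only [Prod.mk.injEq] at h
      obtain ⟨rfl, h⟩ := h
      rw [Fin.ext h]
    exact (hind.precomp hinj).comp _ fun ci => hmeas ci.1
  have hpre : ∀ c i, P.real (D c i ⁻¹' A c) = (ν c).real (A c) := fun c i => by
    rw [← hlaw c i, map_measureReal_apply (hD c i) (hA c)]
  have hint : ∀ ci, ∫ ω, Y ci ω ∂P = e ci.1 * (ν ci.1).real (A ci.1) := fun ci => by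
    simp only [Y, Function.comp_def]
    rw [integral_const_mul, ← hpre ci.1 ci.2]
    congr 1
    exact integral_indicator_one (hD ci.1 ci.2 (hA ci.1))
  have hsq : ∀ ci, ∫ ω, (Y ci ω) ^ 2 ∂P = (ν ci.1).real (A ci.1) := fun ci => by
    rw [← hpre ci.1 ci.2, ← integral_indicator_one (hD ci.1 ci.2 (hA ci.1))]
    refine integral_congr_ae (ae_of_all _ fun ω => ?_)
    by_cases h : D ci.1 ci.2 ω ∈ A ci.1 <;>
      simp [Y, h, Set.indicator, he]
  have hmem : ∀ ci, MemLp (Y ci) 2 P := fun ci => by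
    refine MemLp.of_bound ((hmeas ci.1).comp (hD _ _)).aestronglyMeasurable |e ci.1|
      (ae_of_all _ fun ω => ?_)
    by_cases h : D ci.1 ci.2 ω ∈ A ci.1 <;> simp [Y, h, Set.indicator]
  have hsum : ∀ ω, ∑ ci, Y ci ω =
      ∑ c, e c * (Nat.card {i : Fin (s c) // D c i ω ∈ A c} : ℝ) := fun ω => by
    rw [Fintype.sum_sigma]
    refine Finset.sum_congr rfl fun c _ => ?_
    simp only [Y, Function.comp_def]
    rw [← Finset.mul_sum, Nat.card_eq_fintype_card, Fintype.card_subtype, Finset.card_filter]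
    simp [Set.indicator]
  have key := measure_sum_le_sub_le hY hmem (E := E) (W := W) ha
    (by simpa [hint, Fintype.sum_sigma, mul_left_comm] using hE)
    (by simpa [hsq, Fintype.sum_sigma] using hW)
  simpa only [hsum] using key

/-- A right-continuous monotone function that vanishes on the negative half-line has a nonnegative
quantile at each positive level it exceeds. -/
theorem exists_quantile {F F' : ℝ → ℝ} (hF : Monotone F)
    (hright : ∀ r, Tendsto (fun j : ℕ => F (r + 1 / ((j : ℝ) + 1))) atTop (𝓝 (F r)))
    (hleft : ∀ r, Tendsto (fun j : ℕ => F (r - 1 / ((j : ℝ) + 1))) atTop (𝓝 (F' r)))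
    (hneg : ∀ r < 0, F r = 0) {q b : ℝ} (hq : 0 < q) (hb : q ≤ F b) :
    ∃ r, 0 ≤ r ∧ r ≤ b ∧ q ≤ F r ∧ F' r ≤ q := by
  have hlow : ∀ r ∈ {r | q ≤ F r}, 0 ≤ r := fun r hr => by
    by_contra! h
    have := hneg r h
    rw [Set.mem_ofPred_eq] at hr
    linarith
  have hbdd : BddBelow {r | q ≤ F r} := ⟨0, hlow⟩
  refine ⟨sInf {r | q ≤ F r}, le_csInf ⟨b, hb⟩ hlow, csInf_le hbdd hb, ?_, ?_⟩
  · refine ge_of_tendsto (hright _) (Eventually.of_forall fun j => ?_)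
    obtain ⟨r, hr, hlt⟩ := exists_lt_of_csInf_lt (⟨b, hb⟩ : {r | q ≤ F r}.Nonempty)
      (lt_add_of_pos_right (sInf {r | q ≤ F r}) (Nat.one_div_pos_of_nat (α := ℝ) (n := j)))
    exact le_trans hr (hF hlt.le)
  · refine le_of_tendsto (hleft _) (Eventually.of_forall fun j => ?_)
    by_contra! h
    have := csInf_le hbdd (show _ ∈ {r | q ≤ F r} from h.le)
    have := Nat.one_div_pos_of_nat (α := ℝ) (n := j)
    linarith

theorem tendsto_real_Iic_add (ν : Measure ℝ) [IsFiniteMeasure ν] (r : ℝ) :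
    Tendsto (fun j : ℕ => ν.real (Set.Iic (r + 1 / ((j : ℝ) + 1)))) atTop
      (𝓝 (ν.real (Set.Iic r))) := by
  have hset : Set.Iic r = ⋂ j : ℕ, Set.Iic (r + 1 / ((j : ℝ) + 1)) := by
    ext x
    simp only [Set.mem_Iic, Set.mem_iInter]
    refine ⟨fun h j => ?_, fun h => ?_⟩
    · have := Nat.one_div_pos_of_nat (α := ℝ) (n := j)
      linarith
    · have := tendsto_one_div_add_atTop_nhds_zero_nat (𝕜 := ℝ)
      simpa using ge_of_tendsto (this.const_add r) (Eventually.of_forall h)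
  have h := tendsto_measure_iInter_atTop (μ := ν)
    (s := fun j : ℕ => Set.Iic (r + 1 / ((j : ℝ) + 1))) (fun _ => measurableSet_Iic.nullMeasurableSet)
    (fun i j hij => Set.Iic_subset_Iic.2 (by gcongr)) ⟨0, measure_ne_top _ _⟩
  rw [← hset] at h
  exact (ENNReal.tendsto_toReal (measure_ne_top _ _)).comp h

theorem tendsto_real_Iic_sub (ν : Measure ℝ) [IsFiniteMeasure ν] (r : ℝ) :
    Tendsto (fun j : ℕ => ν.real (Set.Iic (r - 1 / ((j : ℝ) + 1)))) atTop
      (𝓝 (ν.real (Set.Iio r))) := by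
  have hset : Set.Iio r = ⋃ j : ℕ, Set.Iic (r - 1 / ((j : ℝ) + 1)) := by
    ext x
    simp only [Set.mem_Iic, Set.mem_iUnion, Set.mem_Iio]
    refine ⟨fun h => ?_, fun ⟨j, h⟩ => ?_⟩
    · obtain ⟨j, hj⟩ := exists_nat_one_div_lt (sub_pos.2 h)
      exact ⟨j, by linarith⟩
    · have := Nat.one_div_pos_of_nat (α := ℝ) (n := j)
      linarith
  have h := tendsto_measure_iUnion_atTop (μ := ν)
    (s := fun j : ℕ => Set.Iic (r - 1 / ((j : ℝ) + 1)))
    (fun i j hij => Set.Iic_subset_Iic.2 (by gcongr))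
  rw [← hset] at h
  exact (ENNReal.tendsto_toReal (measure_ne_top _ _)).comp h

set_option maxHeartbeats 1000000 in
/-- If the expected number of sample points in `[0, r]` of class `a` exceeds that of class `b` by a
fixed proportion for all small `r`, then class `a` has the majority among the `k` smallest sample
points (with all ties included), with high probability for large `k`. -/
theorem measure_not_majority_le {Ω : Type*} [MeasurableSpace Ω] {P : Measure Ω}
    [IsProbabilityMeasure P] {D : Fin 2 → ℕ → Ω → ℝ} (hD : ∀ c i, Measurable (D c i))
    (hind : iIndepFun (fun ci : Fin 2 × ℕ => D ci.1 ci.2) P) {ν : Fin 2 → Measure ℝ}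
    [∀ c, IsProbabilityMeasure (ν c)]
    (hlaw : ∀ c i, P.map (D c i) = ν c) (hν : ∀ c, ν c (Set.Iio 0) = 0) (s : Fin 2 → ℕ)
    {a b : Fin 2} (hab : a ≠ b) {k : ℕ} (hk : 0 < k) {δ r₀ r₁ : ℝ} (hδ : 0 < δ) (hδ1 : δ ≤ 1)
    (hr₁ : r₁ < r₀)
    (hdom : ∀ r, 0 < r → r < r₀ →
      δ * (s a * (ν a).real (Set.Iic r) + s b * (ν b).real (Set.Iic r)) ≤
        s a * (ν a).real (Set.Iic r) - s b * (ν b).real (Set.Iic r))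
    (hbig : 2 * (k : ℝ) ≤ s a * (ν a).real (Set.Iic r₁) + s b * (ν b).real (Set.Iic r₁))
    (R : Ω → ℝ)
    (hR : ∀ ω, R ω = sInf {r : ℝ | 0 ≤ r ∧ k ≤ Nat.card {i : Fin (s a) // D a i ω ≤ r} +
      Nat.card {i : Fin (s b) // D b i ω ≤ r}}) :
    P {ω | Nat.card {i : Fin (s a) // D a i ω ≤ R ω} ≤ Nat.card {i : Fin (s b) // D b i ω ≤ R ω}} ≤
      ENNReal.ofReal (329 / (δ ^ 2 * k)) := by
  have hk' : (0 : ℝ) < k := by exact_mod_cast hk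
  have hsum2 : ∀ f : Fin 2 → ℝ, ∑ c, f c = f a + f b := fun f => by
    have huniv : ∀ a b : Fin 2, a ≠ b → Finset.univ = {a, b} := by decide
    rw [huniv a b hab, Finset.sum_pair hab]
  set G : Fin 2 → ℝ → ℝ := fun c r => s c * (ν c).real (Set.Iic r) with hG
  set G' : Fin 2 → ℝ → ℝ := fun c r => s c * (ν c).real (Set.Iio r) with hG'
  have hGnn : ∀ c r, 0 ≤ G c r := fun c r => by positivity
  have hGnn' : ∀ c r, 0 ≤ G' c r := fun c r => by positivity
  have hGmono : ∀ c, Monotone (G c) := fun c r r' h =>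
    mul_le_mul_of_nonneg_left (measureReal_mono (Set.Iic_subset_Iic.2 h)) (by positivity)
  have hGlt : ∀ c {r r'}, r < r' → G c r ≤ G' c r' := fun c r r' h =>
    mul_le_mul_of_nonneg_left
      (measureReal_mono fun x (hx : x ≤ r) => (lt_of_le_of_lt hx h : x < r')) (by positivity)
  have hright : ∀ c r, Tendsto (fun j : ℕ => G c (r + 1 / ((j : ℝ) + 1))) atTop (𝓝 (G c r)) :=
    fun c r => (tendsto_real_Iic_add (ν c) r).const_mul _
  have hleft : ∀ c r, Tendsto (fun j : ℕ => G c (r - 1 / ((j : ℝ) + 1))) atTop (𝓝 (G' c r)) :=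
    fun c r => (tendsto_real_Iic_sub (ν c) r).const_mul _
  have hone : Tendsto (fun j : ℕ => 1 / ((j : ℝ) + 1)) atTop (𝓝 0) :=
    tendsto_one_div_add_atTop_nhds_zero_nat
  have hpos : ∀ j : ℕ, 0 < 1 / ((j : ℝ) + 1) := fun j => Nat.one_div_pos_of_nat
  -- The radius $0$ is included by right continuity: with an atom at $0$ the quantile `ρ'` below can
  -- be $0$.
  have hdom0 : ∀ r, 0 ≤ r → r < r₀ → δ * (G a r + G b r) ≤ G a r - G b r := fun r h0 h1 => by
    refine le_of_tendsto_of_tendsto (((hright a r).add (hright b r)).const_mul δ)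
      ((hright a r).sub (hright b r)) ?_
    filter_upwards [hone.eventually (gt_mem_nhds (sub_pos.2 h1))] with j hj
    exact hdom _ (by linarith [hpos j]) (by linarith)
  have hdom' : ∀ r, 0 < r → r < r₀ → δ * (G' a r + G' b r) ≤ G' a r - G' b r := fun r h0 h1 => by
    refine le_of_tendsto_of_tendsto (((hleft a r).add (hleft b r)).const_mul δ)
      ((hleft a r).sub (hleft b r)) ?_
    filter_upwards [hone.eventually (gt_mem_nhds h0)] with j hj
    exact hdom _ (by linarith) (by linarith [hpos j])
  have hneg : ∀ r < 0, G a r + G b r = 0 := fun r hr => by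
    have h : ∀ c, (ν c).real (Set.Iic r) = 0 := fun c =>
      (measureReal_eq_zero_iff).2
        (measure_mono_null (fun x (hx : x ≤ r) => (lt_of_le_of_lt hx hr : x < 0)) (hν c))
    simp [hG, h]
  -- The random radius will be trapped between the quantiles `ρ` and `ρ'` of the expected total
  -- count at the levels $(1\mp\varepsilon)k$. The open interval between them then has expected
  -- count at most $2\varepsilon k=\delta k/4$, too little to overturn a majority of order $\delta
  -- k$.
  set ε : ℝ := δ / 8 with hε
  have hε0 : 0 < ε := by positivity
  have hε1 : ε ≤ 1 / 8 := by rw [hε]; linarith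
  obtain ⟨ρ', h0', h1', h2', h3'⟩ := exists_quantile (F := fun r => G a r + G b r)
    (F' := fun r => G' a r + G' b r) (q := (1 + ε) * k) (b := r₁)
    (fun r r' h => add_le_add (hGmono a h) (hGmono b h))
    (fun r => (hright a r).add (hright b r)) (fun r => (hleft a r).add (hleft b r))
    hneg (by positivity) (le_trans (by nlinarith) hbig)
  obtain ⟨ρ, h0, h1, h2, h3⟩ := exists_quantile (F := fun r => G a r + G b r)
    (F' := fun r => G' a r + G' b r) (q := (1 - ε) * k) (b := ρ')
    (fun r r' h => add_le_add (hGmono a h) (hGmono b h))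
    (fun r => (hright a r).add (hright b r)) (fun r => (hleft a r).add (hleft b r))
    hneg (mul_pos (by linarith) hk') (le_trans (by nlinarith) h2')
  set N : Fin 2 → ℝ → Ω → ℕ := fun c r ω => Nat.card {i : Fin (s c) // D c i ω ≤ r} with hN
  set N' : Fin 2 → ℝ → Ω → ℕ := fun c r ω => Nat.card {i : Fin (s c) // D c i ω < r} with hN'
  have hNmono : ∀ c ω {r r'}, r ≤ r' → N c r ω ≤ N c r' ω := fun c ω r r' h =>
    Nat.card_le_card_of_injective
      (Subtype.map id fun i (hi : D c i ω ≤ r) => (hi.trans h : D c i ω ≤ r'))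
      (Subtype.map_injective _ Function.injective_id)
  have hNlt : ∀ c ω {r r'}, r < r' → N c r ω ≤ N' c r' ω := fun c ω r r' h =>
    Nat.card_le_card_of_injective
      (Subtype.map id fun i (hi : D c i ω ≤ r) => (hi.trans_lt h : D c i ω < r'))
      (Subtype.map_injective _ Function.injective_id)
  -- the four exceptional events
  have evA : P {ω | k ≤ N' a ρ ω + N' b ρ ω} ≤ ENNReal.ofReal (64 / (δ ^ 2 * k)) := by
    have h := measure_signed_count_le hD hind hlaw s (A := fun _ => Set.Iio ρ)
      (fun _ => measurableSet_Iio) (e := fun _ => -1) (by norm_num) (E := -((1 - ε) * k))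
      (W := k) (a := ε * k) (by positivity)
      (by rw [hsum2]; simp only [hG'] at h3; linarith)
      (by rw [hsum2]; simp only [hG'] at h3; nlinarith)
    refine le_trans (measure_mono fun ω hω => ?_) (h.trans (ENNReal.ofReal_le_ofReal ?_))
    · rw [Set.mem_ofPred_eq] at hω ⊢
      rw [hsum2]
      have : (k : ℝ) ≤ N' a ρ ω + N' b ρ ω := by exact_mod_cast hω
      simp only [hN'] at this
      simp only [Set.mem_Iio]
      linarith
    · rw [hε]
      apply le_of_eq
      field_simp
      norm_num
  have evB : P {ω | N a ρ' ω + N b ρ' ω < k} ≤ ENNReal.ofReal (256 / (δ ^ 2 * k)) := by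
    -- An atom at `ρ'` can make `l` much larger than $k$, so the deviation must be measured relative
    -- to `l`. The choice $\varepsilon l/2$ works because $(1-\varepsilon/2)(1+\varepsilon)\ge1$.
    set l := G a ρ' + G b ρ' with hl
    have hl0 : (k : ℝ) ≤ l := by nlinarith
    have h := measure_signed_count_le hD hind hlaw s (A := fun _ => Set.Iic ρ')
      (fun _ => measurableSet_Iic) (e := fun _ => 1) (by norm_num) (E := l)
      (W := l) (a := ε * l / 2) (by have := hk'.trans_le hl0; positivity)
      (by rw [hsum2]; simp only [hl, hG]; linarith)
      (by rw [hsum2])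
    refine le_trans (measure_mono fun ω hω => ?_) (h.trans (ENNReal.ofReal_le_ofReal ?_))
    · rw [Set.mem_ofPred_eq] at hω ⊢
      rw [hsum2]
      have : (N a ρ' ω + N b ρ' ω : ℝ) ≤ k := by exact_mod_cast hω.le
      simp only [hN] at this
      simp only [Set.mem_Iic]
      have : (1 - ε / 2) * ((1 + ε) * k) ≤ (1 - ε / 2) * l :=
        mul_le_mul_of_nonneg_left h2' (by linarith)
      nlinarith [mul_pos hε0 hk']
    · have hlpos := hk'.trans_le hl0
      have : l / (ε * l / 2) ^ 2 = 256 / (δ ^ 2 * l) := by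
        rw [hε]; field_simp; norm_num
      rw [this]
      gcongr
  have evC : P {ω | N a ρ' ω ≤ N b ρ' ω} ≤ ENNReal.ofReal (1 / (δ ^ 2 * k)) := by
    set l := G a ρ' + G b ρ' with hl
    have hl0 : (k : ℝ) ≤ l := by nlinarith
    have hlpos := hk'.trans_le hl0
    have hd := hdom0 ρ' h0' (by linarith)
    have h := measure_signed_count_le hD hind hlaw s (A := fun _ => Set.Iic ρ')
      (fun _ => measurableSet_Iic) (e := fun c => if c = a then 1 else -1)
      (by intro c; split_ifs <;> norm_num) (E := δ * l)
      (W := l) (a := δ * l) (by positivity)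
      (by rw [hsum2]; simp only [if_true, if_neg hab.symm]; simp only [hG] at hd hl; linarith)
      (by rw [hsum2])
    refine le_trans (measure_mono fun ω hω => ?_) (h.trans (ENNReal.ofReal_le_ofReal ?_))
    · rw [Set.mem_ofPred_eq] at hω ⊢
      rw [hsum2]
      have : (N a ρ' ω : ℝ) ≤ N b ρ' ω := by exact_mod_cast hω
      simp only [hN] at this
      simp only [Set.mem_Iic, if_true, if_neg hab.symm]
      linarith
    · have : l / (δ * l) ^ 2 = 1 / (δ ^ 2 * l) := by field_simp
      rw [this]
      gcongr
  have evD : ρ < ρ' → P {ω | N a ρ ω ≤ N' b ρ' ω} ≤ ENNReal.ofReal (8 / (δ ^ 2 * k)) := by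
    intro hρ
    have hd := hdom' ρ' (by linarith) (by linarith)
    have hla := hGlt a hρ
    have hlb := hGlt b hρ
    -- The margin of the open ball at `ρ'` is at least $\delta(1-\varepsilon)k\ge\frac78\delta k$;
    -- shrinking the class `a` count to `ρ` costs at most $2\varepsilon k=\frac28\delta k$.
    have hE : δ * k / 2 ≤ G a ρ - G' b ρ' := by
      have e1 : δ * ((1 - ε) * k) ≤ δ * (G' a ρ' + G' b ρ') :=
        mul_le_mul_of_nonneg_left (by linarith) hδ.le
      have e2 : δ * (ε * k) ≤ δ * k / 8 := by nlinarith [mul_pos hδ hk']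
      have e3 : ε * k = δ * k / 8 := by rw [hε]; ring
      nlinarith
    have hW : G a ρ + G' b ρ' ≤ 2 * k := by nlinarith
    have h := measure_signed_count_le hD hind hlaw s
      (A := fun c => if c = a then Set.Iic ρ else Set.Iio ρ')
      (fun c => by split_ifs; exacts [measurableSet_Iic, measurableSet_Iio])
      (e := fun c => if c = a then 1 else -1)
      (by intro c; split_ifs <;> norm_num) (E := δ * k / 2)
      (W := 2 * k) (a := δ * k / 2) (by positivity)
      (by rw [hsum2]; simp only [if_true, if_neg hab.symm]; simp only [hG, hG'] at hE; linarith)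
      (by rw [hsum2]; simpa only [if_true, if_neg hab.symm] using hW)
    refine le_trans (measure_mono fun ω hω => ?_) (h.trans (ENNReal.ofReal_le_ofReal ?_))
    · rw [Set.mem_ofPred_eq] at hω ⊢
      rw [hsum2]
      have : (N a ρ ω : ℝ) ≤ N' b ρ' ω := by exact_mod_cast hω
      simp only [hN, hN'] at this
      simp only [Set.mem_Iic, Set.mem_Iio, if_true, if_neg hab.symm]
      linarith
    · apply le_of_eq
      field_simp
      norm_num
  -- Off the first two events, `R` lies in $[\rho,\rho']$. At `R = ρ'` all ties at `ρ'` count and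
  -- the third event decides. For `R < ρ'` class `a` has at least its count at `ρ` and class `b` at
  -- most its count strictly below `ρ'`, and the fourth event decides.
  have hsub : {ω | N a (R ω) ω ≤ N b (R ω) ω} ⊆
      (({ω | k ≤ N' a ρ ω + N' b ρ ω} ∪ {ω | N a ρ' ω + N b ρ' ω < k}) ∪
        {ω | N a ρ' ω ≤ N b ρ' ω}) ∪ {ω | ρ < ρ' ∧ N a ρ ω ≤ N' b ρ' ω} := by
    intro ω hω
    by_contra hcon
    simp only [Set.mem_union, Set.mem_ofPred_eq, not_or, not_le, not_lt, not_and] at hcon hω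
    obtain ⟨⟨⟨hA, hB⟩, hC⟩, hDD⟩ := hcon
    have hle : R ω ≤ ρ' := by
      rw [hR]
      exact csInf_le ⟨0, fun r hr => hr.1⟩ ⟨h0', hB⟩
    have hge : ρ ≤ R ω := by
      rw [hR]
      refine le_csInf ⟨ρ', h0', hB⟩ fun r hr => ?_
      by_contra! hlt
      have := hr.2.trans (add_le_add (hNlt a ω hlt) (hNlt b ω hlt))
      omega
    rcases hle.eq_or_lt with heq | hlt
    · rw [heq] at hω
      omega
    · have e1 := hDD (hge.trans_lt hlt)
      have e2 := hNmono a ω hge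
      have e3 := hNlt b ω hlt
      omega
  have evD' : P {ω | ρ < ρ' ∧ N a ρ ω ≤ N' b ρ' ω} ≤ ENNReal.ofReal (8 / (δ ^ 2 * k)) := by
    by_cases h : ρ < ρ'
    · simpa [h] using evD h
    · simp [h]
  refine (measure_mono hsub).trans ((measure_union_le _ _).trans ?_)
  refine (add_le_add ((measure_union_le _ _).trans
    (add_le_add ((measure_union_le _ _).trans (add_le_add evA evB)) evC)) evD').trans ?_
  rw [← ENNReal.ofReal_add (by positivity) (by positivity),
    ← ENNReal.ofReal_add (by positivity) (by positivity),
    ← ENNReal.ofReal_add (by positivity) (by positivity)]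
  -- $64+256+1+8=329$.
  apply le_of_eq
  congr 1
  ring

/-! ### Joint measurability of the $k$NN rule in sample and query point. -/

theorem ballCount_mono {E : Type*} [PseudoMetricSpace E] {m : ℕ} (y : Fin m → E) (x : E) {r r' : ℝ}
    (h : r ≤ r') : ballCount y x r ≤ ballCount y x r' :=
  Nat.card_le_card_of_injective
    (Subtype.map id fun i (hi : dist (y i) x ≤ r) => hi.trans h)
    (Subtype.map_injective _ Function.injective_id)

theorem ballCount_le {E : Type*} [PseudoMetricSpace E] {m : ℕ} (y : Fin m → E) (x : E) (r : ℝ) :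
    ballCount y x r ≤ m := by
  simpa [ballCount] using Nat.card_le_card_of_injective
    (Subtype.val : {i : Fin m // dist (y i) x ≤ r} → Fin m) Subtype.val_injective

theorem ballCount_eq {E : Type*} [PseudoMetricSpace E] {m : ℕ} (y : Fin m → E) (x : E) {r : ℝ}
    (h : ∀ i, dist (y i) x ≤ r) : ballCount y x r = m := by
  simp [ballCount, h]

section Measurability

variable {α E : Type*} [MeasurableSpace α] [PseudoMetricSpace E] [SecondCountableTopology E]
  [MeasurableSpace E] [OpensMeasurableSpace E] {m n : ℕ} {Y : Fin m → α → E} {Z : Fin n → α → E}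
  {X : α → E}

theorem measurable_ballCount (hY : ∀ i, Measurable (Y i)) (hX : Measurable X) {ρ : α → ℝ}
    (hρ : Measurable ρ) : Measurable fun a => ballCount (fun i => Y i a) (X a) (ρ a) := by
  classical
  have h : (fun a => ballCount (fun i => Y i a) (X a) (ρ a)) =
      fun a => ∑ i, if dist (Y i a) (X a) ≤ ρ a then 1 else 0 := by
    ext a
    rw [ballCount, Nat.card_eq_fintype_card, Fintype.card_subtype, Finset.card_filter]
  rw [h]
  refine Finset.measurable_fun_sum _ fun i _ => ?_
  exact Measurable.ite (measurableSet_le ((hY i).dist hX) hρ) measurable_const measurable_const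

/-- Admissible radii form an up-set, so the infimum lies below `q` exactly when some rational radius
below `q` is admissible. This makes it a countable union of measurable conditions. -/
theorem measurable_knnRadius (hY : ∀ i, Measurable (Y i)) (hZ : ∀ i, Measurable (Z i))
    (hX : Measurable X) (k : ℕ) :
    Measurable fun a => knnRadius (fun i => Y i a) (fun i => Z i a) k (X a) := by
  rcases le_or_gt k (m + n) with hk | hk
  · refine measurable_of_Iio fun q => ?_
    have h : (fun a => knnRadius (fun i => Y i a) (fun i => Z i a) k (X a)) ⁻¹' Set.Iio q =
        ⋃ p : ℚ, {a | ((p : ℝ) < q ∧ 0 ≤ (p : ℝ)) ∧ k ≤ ballCount (fun i => Y i a) (X a) p +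
          ballCount (fun i => Z i a) (X a) p} := by
      ext a
      simp only [Set.mem_preimage, Set.mem_Iio, Set.mem_iUnion, Set.mem_ofPred_eq, knnRadius]
      constructor
      · intro hlt
        obtain ⟨r, ⟨hr0, hr⟩, hrq⟩ := exists_lt_of_csInf_lt (by
          refine ⟨∑ i, dist (Y i a) (X a) + ∑ i, dist (Z i a) (X a), by positivity, ?_⟩
          rw [ballCount_eq _ _ fun i => ?_, ballCount_eq _ _ fun i => ?_]
          · exact hk
          · have : dist (Z i a) (X a) ≤ ∑ i, dist (Z i a) (X a) :=
              Finset.single_le_sum (f := fun i => dist (Z i a) (X a))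
              (fun _ _ => dist_nonneg) (Finset.mem_univ i)
            have : 0 ≤ ∑ i, dist (Y i a) (X a) := by positivity
            linarith
          · have : dist (Y i a) (X a) ≤ ∑ i, dist (Y i a) (X a) :=
              Finset.single_le_sum (f := fun i => dist (Y i a) (X a))
              (fun _ _ => dist_nonneg) (Finset.mem_univ i)
            have : 0 ≤ ∑ i, dist (Z i a) (X a) := by positivity
            linarith) hlt
        obtain ⟨p, hp1, hp2⟩ := exists_rat_btwn hrq
        exact ⟨p, ⟨hp2, hr0.trans hp1.le⟩,
          hr.trans (add_le_add (ballCount_mono _ _ hp1.le) (ballCount_mono _ _ hp1.le))⟩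
      · rintro ⟨p, ⟨hp1, hp0⟩, hp⟩
        refine lt_of_le_of_lt (csInf_le ⟨0, fun r hr => ?_⟩ ?_) hp1
        exacts [hr.1, ⟨hp0, hp⟩]
    rw [h]
    refine MeasurableSet.iUnion fun p => (MeasurableSet.const _).inter ?_
    exact measurableSet_le measurable_const
      ((measurable_ballCount hY hX measurable_const).add
        (measurable_ballCount hZ hX measurable_const))
  -- With fewer than $k$ training points no radius is admissible, and `sInf ∅ = 0`.
  · have h : ∀ a, knnRadius (fun i => Y i a) (fun i => Z i a) k (X a) = 0 := fun a => by
      have : {r : ℝ | 0 ≤ r ∧ k ≤ ballCount (fun i => Y i a) (X a) r +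
          ballCount (fun i => Z i a) (X a) r} = ∅ := by
        refine Set.eq_empty_of_forall_notMem fun r hr => ?_
        have h1 := ballCount_le (fun i => Y i a) (X a) r
        have h2 := ballCount_le (fun i => Z i a) (X a) r
        have h3 := hr.2
        omega
      rw [knnRadius, this, Real.sInf_empty]
    simp only [h, measurable_const]

theorem measurable_knnClassifier (hY : ∀ i, Measurable (Y i)) (hZ : ∀ i, Measurable (Z i))
    (hX : Measurable X) (k : ℕ) :
    Measurable fun a => knnClassifier (fun i => Y i a) (fun i => Z i a) k (X a) := by
  classical
  unfold knnClassifier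
  have hR := measurable_knnRadius hY hZ hX k
  exact Measurable.ite (measurableSet_lt (measurable_ballCount hY hX hR)
    (measurable_ballCount hZ hX hR)) measurable_const measurable_const

end Measurability

/-! ### Consistency at a single point. -/

/-- Small balls around a point `x` where the weighted density of class `a` exceeds that of class
`b` contain, for large samples, more points of class `a` in the mean. -/
theorem exists_dominated_radius {E : Type*} [PseudoMetricSpace E] [MeasurableSpace E]
    (μ : Fin 2 → Measure E) [∀ c, IsProbabilityMeasure (μ c)]
    (σ : Measure E) (x : E) (f : Fin 2 → ℝ) (hf : ∀ c, 0 ≤ f c)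
    (hx : ∀ c, Tendsto (fun r => (μ c).real (Metric.closedBall x r) /
      σ.real (Metric.closedBall x r)) (𝓝[>] 0) (𝓝 (f c)))
    {π : Fin 2 → ℝ} (hπ : ∀ c, 0 ≤ π c) {s : ℕ → Fin 2 → ℕ} {M : ℕ → ℕ}
    (hM : Tendsto M atTop atTop)
    (hs : ∀ c, Tendsto (fun N => (s N c : ℝ) / M N) atTop (𝓝 (π c)))
    {k : ℕ → ℕ} (hk : Tendsto (fun N => (k N : ℝ) / M N) atTop (𝓝 0))
    {a b : Fin 2} (hlt : π b * f b < π a * f a) :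
    ∃ δ r₀ r₁ : ℝ, 0 < δ ∧ δ ≤ 1 ∧ r₁ < r₀ ∧ ∀ᶠ N in atTop,
      (∀ r, 0 < r → r < r₀ →
        δ * (s N a * (μ a).real (Metric.closedBall x r) +
          s N b * (μ b).real (Metric.closedBall x r)) ≤
        s N a * (μ a).real (Metric.closedBall x r) -
          s N b * (μ b).real (Metric.closedBall x r)) ∧
      2 * (k N : ℝ) ≤ s N a * (μ a).real (Metric.closedBall x r₁) +
        s N b * (μ b).real (Metric.closedBall x r₁) := by
  have hb0 : 0 ≤ π b * f b := mul_nonneg (hπ b) (hf b)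
  have ha0 : 0 < π a * f a := hb0.trans_lt hlt
  have hπa : 0 < π a := pos_of_mul_pos_left ha0 (hf a)
  have hfa : 0 < f a := pos_of_mul_pos_right ha0 (hπ a)
  set Δ := π a * f a - π b * f b with hΔ
  set Γ := π a * f a + π b * f b with hΓ
  have hΔ0 : 0 < Δ := sub_pos.2 hlt
  have hΓ0 : 0 < Γ := by linarith
  -- This choice leaves the limiting margin $\Delta-\delta\Gamma=\Delta/2>0$.
  set δ := Δ / (2 * Γ) with hδ
  have hδΓ : δ * Γ = Δ / 2 := by rw [hδ]; field_simp
  set u : Fin 2 → ℕ × ℝ → ℝ := fun c q => (s q.1 c : ℝ) / M q.1 *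
    ((μ c).real (Metric.closedBall x q.2) / σ.real (Metric.closedBall x q.2)) with hu
  have hlim : ∀ c, Tendsto (u c) (atTop ×ˢ 𝓝[>] 0) (𝓝 (π c * f c)) := fun c =>
    ((hs c).comp tendsto_fst).mul ((hx c).comp tendsto_snd)
  have hlim2 := ((hlim a).sub (hlim b)).sub (((hlim a).add (hlim b)).const_mul δ)
  have hpos : 0 < π a * f a - π b * f b - δ * (π a * f a + π b * f b) := by
    rw [← hΔ, ← hΓ, hδΓ]; linarith
  -- Convergence along the product filter separates the conditions on `N` and on `r`, so a single
  -- `r₀` serves all large `N`.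
  obtain ⟨pa, hpa, pb, hpb, hpq⟩ := eventually_prod_iff.1 (hlim2.eventually (lt_mem_nhds hpos))
  obtain ⟨r₀, hr₀, hr₀'⟩ := mem_nhdsGT_iff_exists_Ioo_subset.1
    (hpb.and ((hx a).eventually (lt_mem_nhds hfa)))
  have hr₀0 : 0 < r₀ := hr₀
  refine ⟨δ, r₀, r₀ / 2, by positivity, ?_, by linarith, ?_⟩
  · rw [hδ, div_le_one (by positivity)]
    linarith
  have hμa : 0 < (μ a).real (Metric.closedBall x (r₀ / 2)) := by
    have h := (hr₀' ⟨half_pos hr₀0, half_lt_self hr₀0⟩).2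
    refine lt_of_le_of_ne measureReal_nonneg fun h0 => ?_
    rw [← h0, zero_div] at h
    exact lt_irrefl _ h
  have hk2 := hk.const_mul 2
  have hl2 := ((hs a).mul_const ((μ a).real (Metric.closedBall x (r₀ / 2)))).add
    ((hs b).mul_const ((μ b).real (Metric.closedBall x (r₀ / 2))))
  have hlt2 : 2 * (0 : ℝ) < π a * (μ a).real (Metric.closedBall x (r₀ / 2)) +
      π b * (μ b).real (Metric.closedBall x (r₀ / 2)) := by
    have := mul_nonneg (hπ b) (measureReal_nonneg (μ := μ b) (s := Metric.closedBall x (r₀ / 2)))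
    have := mul_pos hπa hμa
    linarith
  filter_upwards [hpa, hk2.eventually_lt hl2 hlt2, hM.eventually_gt_atTop 0] with N hN hN2 hN0
  have hM0 : (0 : ℝ) < M N := by exact_mod_cast hN0
  refine ⟨fun r h0 h1 => ?_, ?_⟩
  · have h := hpq hN (hr₀' ⟨h0, h1⟩).1
    simp only [hu] at h
    set B := Metric.closedBall x r
    rcases (measureReal_nonneg (μ := σ) (s := B)).eq_or_lt with hB | hB
    -- If the ball is $\sigma$-null, every quotient is $0$ by convention and `h` reads $0<0$.
    · simp [← hB] at h
    have hMB : 0 < M N * σ.real B := mul_pos hM0 hB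
    have e : (s N a : ℝ) / M N * ((μ a).real B / σ.real B) -
        s N b / M N * ((μ b).real B / σ.real B) -
        δ * (s N a / M N * ((μ a).real B / σ.real B) +
          s N b / M N * ((μ b).real B / σ.real B)) =
        (s N a * (μ a).real B - s N b * (μ b).real B -
          δ * (s N a * (μ a).real B + s N b * (μ b).real B)) / (M N * σ.real B) := by
      field_simp
    rw [e, div_pos_iff_of_pos_right hMB] at h
    linarith
  · have e1 : 2 * ((k N : ℝ) / M N) = 2 * k N / M N := by ring
    have e2 : (s N a : ℝ) / M N * (μ a).real (Metric.closedBall x (r₀ / 2)) +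
        s N b / M N * (μ b).real (Metric.closedBall x (r₀ / 2)) =
        (s N a * (μ a).real (Metric.closedBall x (r₀ / 2)) +
          s N b * (μ b).real (Metric.closedBall x (r₀ / 2))) / M N := by ring
    rw [e1, e2, div_lt_div_iff_of_pos_right hM0] at hN2
    exact hN2.le

/-- Consistency of the majority vote of the `k` nearest neighbours at a single point. -/
theorem tendsto_measure_not_majority {E : Type*} [PseudoMetricSpace E] [MeasurableSpace E]
    [OpensMeasurableSpace E] {Ω : Type*} [MeasurableSpace Ω] {P : Measure Ω}
    [IsProbabilityMeasure P] (μ : Fin 2 → Measure E) [∀ c, IsProbabilityMeasure (μ c)]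
    {V : Fin 2 → ℕ → Ω → E} (hV : ∀ c i, Measurable (V c i))
    (hind : iIndepFun (fun ci : Fin 2 × ℕ => V ci.1 ci.2) P) (hlaw : ∀ c i, P.map (V c i) = μ c)
    (σ : Measure E) (x : E) (f : Fin 2 → ℝ) (hf : ∀ c, 0 ≤ f c)
    (hx : ∀ c, Tendsto (fun r => (μ c).real (Metric.closedBall x r) /
      σ.real (Metric.closedBall x r)) (𝓝[>] 0) (𝓝 (f c)))
    {π : Fin 2 → ℝ} (hπ : ∀ c, 0 ≤ π c) {s : ℕ → Fin 2 → ℕ} {M : ℕ → ℕ}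
    (hM : Tendsto M atTop atTop)
    (hs : ∀ c, Tendsto (fun N => (s N c : ℝ) / M N) atTop (𝓝 (π c)))
    {k : ℕ → ℕ} (hktop : Tendsto k atTop atTop)
    (hk : Tendsto (fun N => (k N : ℝ) / M N) atTop (𝓝 0))
    {a b : Fin 2} (hab : a ≠ b) (hlt : π b * f b < π a * f a) (R : ℕ → Ω → ℝ)
    (hR : ∀ N ω, R N ω = sInf {r : ℝ | 0 ≤ r ∧ k N ≤
      ballCount (fun i : Fin (s N a) => V a i ω) x r +
      ballCount (fun i : Fin (s N b) => V b i ω) x r}) :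
    Tendsto (fun N => P {ω | ballCount (fun i : Fin (s N a) => V a i ω) x (R N ω) ≤
      ballCount (fun i : Fin (s N b) => V b i ω) x (R N ω)}) atTop (𝓝 0) := by
  obtain ⟨δ, r₀, r₁, hδ, hδ1, hr₁, hev⟩ := exists_dominated_radius μ σ x f hf hx hπ hM hs hk hlt
  have hdist : Measurable fun y : E => dist y x := (continuous_id.dist continuous_const).measurable
  have hIic : ∀ c r, ((μ c).map fun y => dist y x).real (Set.Iic r) =
      (μ c).real (Metric.closedBall x r) := fun c r => by
    rw [map_measureReal_apply hdist measurableSet_Iic]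
    rfl
  have hprob : ∀ c, IsProbabilityMeasure ((μ c).map fun y => dist y x) := fun c =>
    Measure.isProbabilityMeasure_map hdist.aemeasurable
  have hzero : Tendsto (fun N => ENNReal.ofReal (329 / (δ ^ 2 * k N))) atTop (𝓝 0) := by
    rw [← ENNReal.ofReal_zero]
    refine ENNReal.tendsto_ofReal (Tendsto.div_atTop tendsto_const_nhds ?_)
    exact (tendsto_natCast_atTop_atTop.comp hktop).const_mul_atTop (by positivity)
  refine tendsto_of_tendsto_of_tendsto_of_le_of_le' tendsto_const_nhds hzero
    (Eventually.of_forall fun _ => zero_le) ?_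
  filter_upwards [hev, hktop.eventually_gt_atTop 0] with N hN hN0
  refine measure_not_majority_le (D := fun c i ω => dist (V c i ω) x)
    (fun c i => hdist.comp (hV c i)) (hind.comp (fun _ y => dist y x) fun _ => hdist)
    (ν := fun c => (μ c).map fun y => dist y x) (fun c i => ?_) (fun c => ?_) (s N) hab hN0 hδ hδ1
    hr₁ ?_ ?_ (R N) (hR N)
  · rw [← hlaw c i, Measure.map_map hdist (hV c i)]
    rfl
  · rw [Measure.map_apply hdist measurableSet_Iio]
    convert measure_empty (μ := μ c)
    ext y
    simp [dist_nonneg]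
  · simpa only [hIic] using hN.1
  · simpa only [hIic] using hN.2

/-! ### Excess risk and the Bayes rule. -/

section Excess

variable {E : Type*} [MeasurableSpace E] {μ : Fin 2 → Measure E} [∀ c, IsProbabilityMeasure (μ c)]
  {σ : Measure E} [SigmaFinite σ]

/-- The risk as an integral of the weighted density of the class that is not chosen. -/
theorem risk_eq_integral (hac : ∀ c, μ c ≪ σ) (π : Fin 2 → ℝ) {g : E → Fin 2}
    (hg : Measurable g) :
    Integrable (fun x => if g x = 1 then π 0 * ((μ 0).rnDeriv σ x).toReal
      else π 1 * ((μ 1).rnDeriv σ x).toReal) σ ∧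
    risk π μ g = ∫ x, (if g x = 1 then π 0 * ((μ 0).rnDeriv σ x).toReal
      else π 1 * ((μ 1).rnDeriv σ x).toReal) ∂σ := by
  have hm : MeasurableSet {x | g x = 1} := hg (measurableSet_singleton 1)
  have hc : {x | g x = 1}ᶜ = {x | g x = 0} := by
    ext x
    simp only [Set.mem_compl_iff, Set.mem_ofPred_eq]
    generalize g x = c
    revert c
    decide
  have hint : ∀ c, Integrable (fun x => π c * ((μ c).rnDeriv σ x).toReal) σ := fun c =>
    Measure.integrable_toReal_rnDeriv.const_mul _
  have hI : Integrable (fun x => if g x = 1 then π 0 * ((μ 0).rnDeriv σ x).toReal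
      else π 1 * ((μ 1).rnDeriv σ x).toReal) σ := by
    classical
    refine (Integrable.piecewise hm (hint 0).integrableOn (hint 1).integrableOn).congr
      (ae_of_all _ fun x => ?_)
    by_cases hx : g x = 1 <;> simp [Set.piecewise, hx]
  refine ⟨hI, ?_⟩
  rw [← integral_add_compl hm hI, setIntegral_congr_fun hm (g := fun x => π 0 *
      ((μ 0).rnDeriv σ x).toReal) (fun x (hx : g x = 1) => by simp [hx]),
    setIntegral_congr_fun hm.compl (g := fun x => π 1 * ((μ 1).rnDeriv σ x).toReal)
      (fun x (hx : ¬ g x = 1) => by simp [hx]),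
    integral_const_mul, integral_const_mul, Measure.setIntegral_toReal_rnDeriv (hac 0),
    Measure.setIntegral_toReal_rnDeriv (hac 1), hc, risk]

/-- The Bayes rule chooses the class with the larger weighted density. -/
theorem exists_bayes_rule (hac : ∀ c, μ c ≪ σ) (π : Fin 2 → ℝ) :
    ∃ h : E → ℝ, Integrable h σ ∧ Measurable h ∧
      (∀ x, h x = π 1 * ((μ 1).rnDeriv σ x).toReal - π 0 * ((μ 0).rnDeriv σ x).toReal) ∧
      ∀ g : E → Fin 2, Measurable g → edist (risk π μ g) (bayesRisk π μ) ≤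
        ∫⁻ x, {x | ¬ (g x = 1 ↔ 0 < h x)}.indicator (fun x => ‖h x‖ₑ) x ∂σ := by
  classical
  set h : E → ℝ := fun x =>
    π 1 * ((μ 1).rnDeriv σ x).toReal - π 0 * ((μ 0).rnDeriv σ x).toReal with hh
  have hmeas : Measurable h := by
    have := fun c => Measure.measurable_rnDeriv (μ c) σ
    fun_prop
  have hint : Integrable h σ := (Measure.integrable_toReal_rnDeriv.const_mul _).sub
    (Measure.integrable_toReal_rnDeriv.const_mul _)
  refine ⟨h, hint, hmeas, fun _ => rfl, fun g hg => ?_⟩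
  set g₀ : E → Fin 2 := fun x => if 0 < h x then 1 else 0 with hg₀
  have hg₀m : Measurable g₀ :=
    Measurable.ite (measurableSet_lt measurable_const hmeas) measurable_const measurable_const
  -- The two integrands differ only where the decisions differ, and there by $|h|$. The difference
  -- is therefore nonnegative, which identifies `g₀` as a minimiser.
  have hdiff : ∀ g : E → Fin 2, Measurable g → risk π μ g - risk π μ g₀ =
      ∫ x, {x | ¬ (g x = 1 ↔ 0 < h x)}.indicator (fun x => |h x|) x ∂σ := fun g hg => by
    rw [(risk_eq_integral hac π hg).2, (risk_eq_integral hac π hg₀m).2,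
      ← integral_sub (risk_eq_integral hac π hg).1 (risk_eq_integral hac π hg₀m).1]
    refine integral_congr_ae (ae_of_all _ fun x => ?_)
    by_cases h1 : g x = 1 <;> by_cases h2 : 0 < h x
    · simp [hg₀, h1, h2]
    · have h3 := abs_of_nonpos (not_lt.1 h2)
      simp [hg₀, h1, h2, h3]
      simp only [hh]
      ring
    · have h3 := abs_of_pos h2
      simp [hg₀, h1, h2, h3]
      simp only [hh]
    · simp [hg₀, h1, h2]
  have hbayes : bayesRisk π μ = risk π μ g₀ := by
    have hle : ∀ g : {g : E → Fin 2 // Measurable g}, risk π μ g₀ ≤ risk π μ g.1 := fun g => by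
      rw [← sub_nonneg, hdiff g.1 g.2]
      exact integral_nonneg fun x => Set.indicator_nonneg (fun _ _ => abs_nonneg _) _
    have : Nonempty {g : E → Fin 2 // Measurable g} := ⟨⟨g₀, hg₀m⟩⟩
    exact le_antisymm (ciInf_le ⟨_, by rintro _ ⟨g, rfl⟩; exact hle g⟩
      (⟨g₀, hg₀m⟩ : {g : E → Fin 2 // Measurable g})) (le_ciInf hle)
  rw [hbayes, edist_dist, Real.dist_eq, hdiff g hg, ← Real.norm_eq_abs, ofReal_norm]
  refine (enorm_integral_le_lintegral_enorm _).trans (le_of_eq ?_)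
  refine lintegral_congr fun x => ?_
  rw [enorm_indicator_eq_indicator_enorm]
  simp only [Real.enorm_abs]

end Excess

/-! ### Universal consistency of $k$NN. -/

/-- At almost no point the `k`-nearest-neighbour rule disagrees, in the limit, with the Bayes
rule. -/
theorem ae_tendsto_measure_disagree {E : Type*} [MetricSpace E] [MeasurableSpace E] [BorelSpace E]
    [SecondCountableTopology E] [HasBesicovitchCovering E]
    {Ω : Type*} [MeasurableSpace Ω] {P : Measure Ω}
    [IsProbabilityMeasure P] (μ : Fin 2 → Measure E) [∀ c, IsProbabilityMeasure (μ c)]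
    {V : Fin 2 → ℕ → Ω → E} (hV : ∀ c i, Measurable (V c i))
    (hind : iIndepFun (fun ci : Fin 2 × ℕ => V ci.1 ci.2) P) (hlaw : ∀ c i, P.map (V c i) = μ c)
    (σ : Measure E) [IsFiniteMeasure σ]
    {π : Fin 2 → ℝ} (hπ : ∀ c, 0 ≤ π c) {s : ℕ → Fin 2 → ℕ} {M : ℕ → ℕ}
    (hM : Tendsto M atTop atTop)
    (hs : ∀ c, Tendsto (fun N => (s N c : ℝ) / M N) atTop (𝓝 (π c)))
    {k : ℕ → ℕ} (hktop : Tendsto k atTop atTop)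
    (hk : Tendsto (fun N => (k N : ℝ) / M N) atTop (𝓝 0)) :
    ∀ᵐ x ∂σ, π 1 * ((μ 1).rnDeriv σ x).toReal - π 0 * ((μ 0).rnDeriv σ x).toReal ≠ 0 →
      Tendsto (fun N => P {ω | ¬ (knnClassifier (fun i : Fin (s N 0) => V 0 i ω)
        (fun i : Fin (s N 1) => V 1 i ω) (k N) x = 1 ↔
          0 < π 1 * ((μ 1).rnDeriv σ x).toReal - π 0 * ((μ 0).rnDeriv σ x).toReal)})
        atTop (𝓝 0) := by
  have hd := ae_all_iff.2 fun c => Besicovitch.ae_tendsto_rnDeriv (μ c) σ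
  have hfin := ae_all_iff.2 fun c => Measure.rnDeriv_lt_top (μ c) σ
  filter_upwards [hd, hfin] with x hx hxf h0
  have hx' : ∀ c, Tendsto (fun r => (μ c).real (Metric.closedBall x r) /
      σ.real (Metric.closedBall x r)) (𝓝[>] 0) (𝓝 ((μ c).rnDeriv σ x).toReal) := fun c => by
    have := (ENNReal.tendsto_toReal (hxf c).ne).comp (hx c)
    simpa only [Function.comp_def, ENNReal.toReal_div, Measure.real] using this
  rcases h0.lt_or_gt with h0 | h0
  · have hlt : π 1 * ((μ 1).rnDeriv σ x).toReal < π 0 * ((μ 0).rnDeriv σ x).toReal := by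
      linarith
    have := tendsto_measure_not_majority μ hV hind hlaw σ x
      (fun c => ((μ c).rnDeriv σ x).toReal) (fun _ => ENNReal.toReal_nonneg) hx' hπ hM hs hktop hk
      (a := 0) (b := 1) (by decide) hlt (fun N ω => knnRadius (fun i : Fin (s N 0) => V 0 i ω)
        (fun i : Fin (s N 1) => V 1 i ω) (k N) x) (fun N ω => rfl)
    refine tendsto_of_tendsto_of_tendsto_of_le_of_le tendsto_const_nhds this
      (fun _ => zero_le) fun N => measure_mono fun ω hω => ?_
    simp only [knnClassifier, Set.mem_ofPred_eq, not_lt.2 h0.le] at hω ⊢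
    by_contra hcon
    exact hω (by rw [if_neg (by omega)]; decide)
  · have hlt : π 0 * ((μ 0).rnDeriv σ x).toReal < π 1 * ((μ 1).rnDeriv σ x).toReal := by
      linarith
    have := tendsto_measure_not_majority μ hV hind hlaw σ x
      (fun c => ((μ c).rnDeriv σ x).toReal) (fun _ => ENNReal.toReal_nonneg) hx' hπ hM hs hktop hk
      (a := 1) (b := 0) (by decide) hlt (fun N ω => knnRadius (fun i : Fin (s N 0) => V 0 i ω)
        (fun i : Fin (s N 1) => V 1 i ω) (k N) x)
      (fun N ω => by simp only [knnRadius, add_comm])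
    refine tendsto_of_tendsto_of_tendsto_of_le_of_le tendsto_const_nhds this
      (fun _ => zero_le) fun N => measure_mono fun ω hω => ?_
    simp only [knnClassifier, Set.mem_ofPred_eq, h0] at hω ⊢
    by_contra hcon
    exact hω (by rw [if_pos (by omega)]; simp)

/-- Universal consistency of the `k`-nearest-neighbour rule for separate samples of two classes. -/
theorem bayesOptimal_knnClassifier {E : Type*} [MetricSpace E] [MeasurableSpace E] [BorelSpace E]
    [SecondCountableTopology E] [HasBesicovitchCovering E]
    {Ω : Type*} [MeasurableSpace Ω] {P : Measure Ω}
    [IsProbabilityMeasure P] (μ : Fin 2 → Measure E) [∀ c, IsProbabilityMeasure (μ c)]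
    {V : Fin 2 → ℕ → Ω → E} (hV : ∀ c i, Measurable (V c i))
    (hind : iIndepFun (fun ci : Fin 2 × ℕ => V ci.1 ci.2) P) (hlaw : ∀ c i, P.map (V c i) = μ c)
    {π : Fin 2 → ℝ} (hπ : ∀ c, 0 ≤ π c) {s : ℕ → Fin 2 → ℕ} {M : ℕ → ℕ}
    (hM : Tendsto M atTop atTop)
    (hs : ∀ c, Tendsto (fun N => (s N c : ℝ) / M N) atTop (𝓝 (π c)))
    {k : ℕ → ℕ} (hktop : Tendsto k atTop atTop)
    (hk : Tendsto (fun N => (k N : ℝ) / M N) atTop (𝓝 0)) :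
    BayesOptimal P π μ (fun N ω => knnClassifier (fun i : Fin (s N 0) => V 0 i ω)
      (fun i : Fin (s N 1) => V 1 i ω) (k N)) := by
  set σ : Measure E := μ 0 + μ 1 with hσ
  have hac : ∀ c, μ c ≪ σ := by
    rw [Fin.forall_fin_two]
    exact ⟨Measure.le_add_right le_rfl |>.absolutelyContinuous,
      Measure.le_add_left le_rfl |>.absolutelyContinuous⟩
  obtain ⟨h, hint, hmeas, hh, hexc⟩ := exists_bayes_rule hac π
  set κ : ℕ → Ω × E → Fin 2 := fun N q => knnClassifier (fun i : Fin (s N 0) => V 0 i q.1)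
      (fun i : Fin (s N 1) => V 1 i q.1) (k N) q.2 with hκ
  have hκm : ∀ N, Measurable (κ N) := fun N =>
    measurable_knnClassifier (fun i => (hV 0 i).comp measurable_fst)
      (fun i => (hV 1 i).comp measurable_fst) measurable_snd (k N)
  set B : ℕ → Set (Ω × E) := fun N => {q | ¬ (κ N q = 1 ↔ 0 < h q.2)} with hB
  have hBm : ∀ N, MeasurableSet (B N) := fun N =>
    (MeasurableSet.iff (hκm N (measurableSet_singleton 1))
      (measurableSet_lt measurable_const (hmeas.comp measurable_snd))).compl
  have hpt : ∀ᵐ x ∂σ, h x ≠ 0 → Tendsto (fun N => P {ω | (ω, x) ∈ B N}) atTop (𝓝 0) := by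
    simp only [hB, hκ, Set.mem_ofPred_eq, hh]
    exact ae_tendsto_measure_disagree μ hV hind hlaw σ hπ hM hs hktop hk
  -- Dominated convergence with majorant $|h|$. Points with $h=0$, where the vote may never settle,
  -- contribute nothing.
  have hlint : Tendsto (fun N => ∫⁻ x, ‖h x‖ₑ * P {ω | (ω, x) ∈ B N} ∂σ) atTop (𝓝 0) := by
    have := tendsto_lintegral_of_dominated_convergence (μ := σ)
      (F := fun N x => ‖h x‖ₑ * P {ω | (ω, x) ∈ B N}) (f := fun _ => 0) (fun x => ‖h x‖ₑ)
      (fun N => hmeas.enorm.mul (measurable_measure_prodMk_right (hBm N)))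
      (fun N => ae_of_all _ fun x => mul_le_of_le_one_right zero_le prob_le_one)
      hint.2.ne ?_
    · simpa using this
    · filter_upwards [hpt] with x hx
      by_cases h0 : h x = 0
      · simp [h0]
      · simpa using ENNReal.Tendsto.const_mul (hx h0) (Or.inr enorm_ne_top)
  set Q : ℕ → Ω → ENNReal := fun N ω => ∫⁻ x, (B N).indicator (fun q => ‖h q.2‖ₑ) (ω, x) ∂σ with hQ
  have hQm : ∀ N, Measurable (fun q : Ω × E => (B N).indicator (fun q => ‖h q.2‖ₑ) q) := fun N =>
    (hmeas.comp measurable_snd).enorm.indicator (hBm N)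
  -- By Tonelli, the mean of the excess risk bound `Q N` is the integral just shown to vanish in the
  -- limit; Markov's inequality finishes the proof.
  have hQint : ∀ N, ∫⁻ ω, Q N ω ∂P = ∫⁻ x, ‖h x‖ₑ * P {ω | (ω, x) ∈ B N} ∂σ := fun N => by
    rw [lintegral_lintegral_swap (hQm N).aemeasurable]
    refine lintegral_congr fun x => ?_
    have hmx : MeasurableSet {ω | (ω, x) ∈ B N} := (measurable_prodMk_right (y := x)) (hBm N)
    rw [← lintegral_indicator_const hmx]
    rfl
  intro ε hε
  rcases eq_or_ne ε ⊤ with rfl | hεt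
  · simp [edist_ne_top]
  have hlim : Tendsto (fun N => (∫⁻ ω, Q N ω ∂P) / ε) atTop (𝓝 0) := by
    simp only [hQint]
    simpa using ENNReal.Tendsto.div_const hlint (Or.inr hε.ne')
  refine tendsto_of_tendsto_of_tendsto_of_le_of_le tendsto_const_nhds hlim
    (fun _ => zero_le) fun N => ?_
  refine le_trans (measure_mono fun ω hω => ?_)
    (meas_ge_le_lintegral_div (hQm N).lintegral_prod_right'.aemeasurable hε.ne' hεt)
  rw [Set.mem_ofPred_eq] at hω ⊢
  exact hω.trans (hexc (fun x => κ N (ω, x)) ((hκm N).comp measurable_prodMk_left))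

/-! ### Injectivity of the location coordinates. -/

/-- A piecewise linear function with `p + 1` knots of mutual distance more than `h` vanishes at the
knots if it has a zero in each of the `L` cells of length `h`. -/
theorem eq_zero_of_zeros_in_cells {x : ℝ → ℝ} {τ w : ℕ → ℝ} {p L : ℕ} {h : ℝ} (hh : 0 < h)
    (hL : 0 < L) (hgap : ∀ j < p, h < τ (j + 1) - τ j) (h0 : 0 ≤ τ 0) (hp : τ p ≤ L * h)
    (hleft : ∀ r ≤ τ 0, x r = w 0) (hright : ∀ r, τ p ≤ r → x r = w p)
    (hmid : ∀ j < p, ∀ r, τ j ≤ r → r ≤ τ (j + 1) →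
      x r = w j + (w (j + 1) - w j) * ((r - τ j) / (τ (j + 1) - τ j)))
    (hzero : ∀ i < L, ∃ z, i * h < z ∧ z < (i + 1) * h ∧ x z = 0) :
    ∀ j ≤ p, w j = 0 := by
  have hadd : ∀ k i, i + k ≤ p → τ i + k * h ≤ τ (i + k) := by
    intro k i
    induction k with
    | zero => simp
    | succ k ih =>
      intro hik
      have h1 := ih (by omega)
      have h2 := hgap (i + k) (by omega)
      rw [← add_assoc i k 1]
      push_cast
      linarith
  have hmono : ∀ j ≤ p, τ j ≤ L * h := fun j hj => by
    obtain ⟨k, rfl⟩ := Nat.exists_eq_add_of_le hj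
    have := hadd k j le_rfl
    have : 0 ≤ k * h := by positivity
    linarith
  have hτnn : ∀ j ≤ p, 0 ≤ τ j := fun j hj => by
    have h1 := hadd j 0 (by omega)
    rw [zero_add] at h1
    have : 0 ≤ j * h := by positivity
    linarith
  choose! z hz1 hz2 hz3 using hzero
  intro c
  induction c using Nat.strong_induction_on with
  | _ c ih =>
  intro hc
  by_contra hwc
  -- Here `c` is the first knot with a nonzero value. The function has no zero between the left end
  -- of cell `g` and that knot: it is constant there if `c` is the first knot, and otherwise on a
  -- segment rising or falling from the value $0$ at the previous knot, whose position is rounded up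
  -- to a cell boundary. Rounding loses less than one cell, so cell `g + k` still ends before knot
  -- `c + k + 1`.
  obtain ⟨g, hg1, hg2, hg3⟩ : ∃ g : ℕ, (∀ k, c + k ≤ p → g + k < L) ∧
      (∀ k, c + k + 1 ≤ p → ((g + k : ℕ) + 1) * h < τ (c + k + 1)) ∧
      ∀ r, g * h < r → r ≤ τ c → x r ≠ 0 := by
    rcases c with _ | c
    · refine ⟨0, fun k hk => ?_, fun k hk => ?_, fun r _ hr => by rwa [hleft r hr]⟩
      · rcases k with _ | k
        · simpa using hL
        · have h1 := hadd k 0 (by omega)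
          have h2 := hgap k (by omega)
          have h3 := hmono (k + 1) (by omega)
          rw [zero_add] at h1 ⊢
          have : ((k + 1 : ℕ) : ℝ) * h < L * h := by push_cast; linarith
          exact_mod_cast lt_of_mul_lt_mul_right this hh.le
      · have h1 := hadd k 0 (by omega)
        have h2 := hgap k (by omega)
        simp only [zero_add] at h1 ⊢
        linarith
    · have ha := hτnn c (by omega)
      have hc1 : τ c ≤ ⌈τ c / h⌉₊ * h := (div_le_iff₀ hh).1 (Nat.le_ceil _)
      have hc2 : (⌈τ c / h⌉₊ : ℝ) * h < τ c + h := by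
        have := mul_lt_mul_of_pos_right (Nat.ceil_lt_add_one (div_nonneg ha hh.le)) hh
        rwa [add_mul, div_mul_cancel₀ _ hh.ne', one_mul] at this
      refine ⟨⌈τ c / h⌉₊, fun k hk => ?_, fun k hk => ?_, fun r hr hr' => ?_⟩
      · have h1 := hadd (k + 1) c (by omega)
        have h2 := hmono (c + (k + 1)) (by omega)
        have : ((⌈τ c / h⌉₊ + k : ℕ) : ℝ) * h < L * h := by push_cast at h1 ⊢; linarith
        exact_mod_cast lt_of_mul_lt_mul_right this hh.le
      · have h1 := hadd (k + 2) c (by omega)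
        rw [show c + 1 + k + 1 = c + (k + 2) by ring]
        push_cast at h1 ⊢
        linarith
      · have hg := hgap c (by omega)
        rw [hmid c (by omega) r (by linarith) hr', ih c (by omega) (by omega), sub_zero, zero_add]
        exact mul_ne_zero hwc (div_ne_zero (by linarith) (by linarith))
  -- The zero of cell `g + k` falls strictly inside segment `c + k`. That segment starts at a
  -- nonzero value, so it has no second zero: its right end value is nonzero, and the zero of the
  -- next cell is pushed beyond it. After the last knot the function is a nonzero constant, yet a
  -- zero remains.
  have key : ∀ k, c + k ≤ p → w (c + k) ≠ 0 ∧ τ (c + k) < z (g + k) := by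
    intro k
    induction k with
    | zero =>
      intro _
      refine ⟨hwc, ?_⟩
      by_contra! hle
      have hgL := hg1 0 (by omega)
      exact hg3 _ (hz1 g hgL) hle (hz3 g hgL)
    | succ k ihk =>
      intro hk
      obtain ⟨hw, hτ⟩ := ihk (by omega)
      have hgap' := hgap (c + k) (by omega)
      have hpos : 0 < τ (c + k + 1) - τ (c + k) := hh.trans hgap'
      have hgk := hg1 k (by omega)
      have hgk' := hg1 (k + 1) hk
      have hlt : z (g + k) < τ (c + k + 1) := (hz2 _ hgk).trans (hg2 k hk)
      have e1 := hmid (c + k) (by omega) (z (g + k)) hτ.le hlt.le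
      rw [hz3 _ hgk] at e1
      have hne : w (c + k + 1) ≠ 0 := by
        intro h0
        rw [h0] at e1
        have : w (c + k) * (1 - (z (g + k) - τ (c + k)) / (τ (c + k + 1) - τ (c + k))) = 0 := by
          linarith
        rcases mul_eq_zero.1 this with h1 | h1
        · exact hw h1
        · have h2 := (div_lt_one hpos).2 (sub_lt_sub_right hlt (τ (c + k)))
          linarith
      refine ⟨hne, ?_⟩
      by_contra! hle
      have hzz : z (g + k) < z (g + (k + 1)) := by
        have h1 := hz2 _ hgk
        have h2 := hz1 _ hgk'
        push_cast at h1 h2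
        linarith
      have e2 := hmid (c + k) (by omega) (z (g + (k + 1))) (by linarith) hle
      rw [hz3 _ hgk'] at e2
      have h3 : (w (c + k + 1) - w (c + k)) * ((z (g + (k + 1)) - z (g + k)) /
          (τ (c + k + 1) - τ (c + k))) = 0 := by
        have : (z (g + (k + 1)) - z (g + k)) / (τ (c + k + 1) - τ (c + k)) =
          (z (g + (k + 1)) - τ (c + k)) / (τ (c + k + 1) - τ (c + k)) -
            (z (g + k) - τ (c + k)) / (τ (c + k + 1) - τ (c + k)) := by ring
        rw [this]
        linarith
      rcases mul_eq_zero.1 h3 with h4 | h4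
      · rw [h4, zero_mul, add_zero] at e1
        exact hw e1.symm
      · exact (div_pos (sub_pos.2 hzz) hpos).ne' h4
  obtain ⟨k, rfl⟩ := Nat.exists_eq_add_of_le hc
  obtain ⟨hw, hτ⟩ := key k le_rfl
  exact hw (by rw [← hright _ hτ.le, hz3 _ (hg1 k le_rfl)])

theorem linInterp_sub {p : ℕ} (t v v' : Fin (p + 1) → ℝ) (r : ℝ) :
    linInterp t (v - v') r = linInterp t v r - linInterp t v' r := by
  simp only [linInterp, Pi.sub_apply]
  rw [add_sub_add_comm, ← Finset.sum_sub_distrib]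
  congr 1
  exact Finset.sum_congr rfl fun j _ => by ring

theorem continuous_linInterp {p : ℕ} (t : Fin (p + 1) → ℝ) :
    Continuous (Function.uncurry (linInterp t)) := by
  unfold Function.uncurry linInterp
  fun_prop

theorem ramp_eq_zero {a b r : ℝ} (hab : a < b) (hr : r ≤ a) :
    max 0 (min 1 ((r - a) / (b - a))) = 0 :=
  max_eq_left ((min_le_right _ _).trans
    (div_nonpos_of_nonpos_of_nonneg (sub_nonpos.2 hr) (sub_pos.2 hab).le))

theorem ramp_eq_one {a b r : ℝ} (hab : a < b) (hr : b ≤ r) :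
    max 0 (min 1 ((r - a) / (b - a))) = 1 := by
  rw [min_eq_left, max_eq_right zero_le_one]
  rw [le_div_iff₀ (sub_pos.2 hab)]
  linarith

theorem ramp_eq_div {a b r : ℝ} (hab : a < b) (hr : a ≤ r) (hr' : r ≤ b) :
    max 0 (min 1 ((r - a) / (b - a))) = (r - a) / (b - a) := by
  have := sub_pos.2 hab
  rw [min_eq_right ((div_le_one this).2 (by linarith)),
    max_eq_right (div_nonneg (sub_nonneg.2 hr) this.le)]

theorem linInterp_of_le {p : ℕ} {t : Fin (p + 1) → ℝ} (ht : StrictMono t)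
    (v : Fin (p + 1) → ℝ) {r : ℝ} (hr : r ≤ t 0) : linInterp t v r = v 0 := by
  rw [linInterp, Finset.sum_eq_zero, add_zero]
  intro j _
  rw [ramp_eq_zero (ht Fin.castSucc_lt_succ) (hr.trans (ht.monotone (Fin.zero_le _))), mul_zero]

theorem linInterp_of_ge {p : ℕ} {t : Fin (p + 1) → ℝ} (ht : StrictMono t)
    (v : Fin (p + 1) → ℝ) {r : ℝ} (hr : t (Fin.last p) ≤ r) :
    linInterp t v r = v (Fin.last p) := by
  rw [← linInterp_apply t v ht (Fin.last p), linInterp, linInterp]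
  congr 1
  refine Finset.sum_congr rfl fun j _ => ?_
  have hj : t j.succ ≤ t (Fin.last p) := ht.monotone (Fin.le_last _)
  rw [ramp_eq_one (ht Fin.castSucc_lt_succ) hj, ramp_eq_one (ht Fin.castSucc_lt_succ) (hj.trans hr)]

theorem linInterp_of_mem {p : ℕ} {t : Fin (p + 1) → ℝ} (ht : StrictMono t)
    (v : Fin (p + 1) → ℝ) (j : Fin p) {r : ℝ} (hr : t j.castSucc ≤ r) (hr' : r ≤ t j.succ) :
    linInterp t v r = v j.castSucc + (v j.succ - v j.castSucc) *
      ((r - t j.castSucc) / (t j.succ - t j.castSucc)) := by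
  -- Subtracting the value at the left knot cancels every ramp except the `j`-th, as the others are
  -- constant on this segment.
  have key : linInterp t v r - linInterp t v (t j.castSucc) = (v j.succ - v j.castSucc) *
      ((r - t j.castSucc) / (t j.succ - t j.castSucc)) := by
    rw [linInterp, linInterp, add_sub_add_left_eq_sub, ← Finset.sum_sub_distrib,
      Finset.sum_eq_single j]
    · rw [ramp_eq_div (ht Fin.castSucc_lt_succ) hr hr', ramp_eq_zero (ht Fin.castSucc_lt_succ) le_rfl]
      ring
    · intro i _ hij
      rcases lt_or_gt_of_ne hij with h | h
      · have hle : t i.succ ≤ t j.castSucc := ht.monotone (Fin.succ_le_castSucc_iff.2 h)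
        rw [ramp_eq_one (ht Fin.castSucc_lt_succ) hle,
          ramp_eq_one (ht Fin.castSucc_lt_succ) (hle.trans hr), sub_self]
      · have hle : t j.succ ≤ t i.castSucc := ht.monotone (Fin.succ_le_castSucc_iff.2 h)
        rw [ramp_eq_zero (ht Fin.castSucc_lt_succ) (hr'.trans hle),
          ramp_eq_zero (ht Fin.castSucc_lt_succ) ((hr.trans hr').trans hle), sub_self]
    · simp
  rw [← key, linInterp_apply t v ht]
  ring

/-- Rolle's theorem for the primitive, which places the zero in the open interval; the strict
inequalities are needed to keep zeros of adjacent cells distinct. -/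
theorem exists_zero_of_integral_eq_zero {f : ℝ → ℝ} (hf : Continuous f) {a b : ℝ} (hab : a < b)
    (h : ∫ r in a..b, f r = 0) : ∃ z, a < z ∧ z < b ∧ f z = 0 := by
  have hd : ∀ u, HasDerivAt (fun u => ∫ r in a..u, f r) (f u) u := fun u =>
    intervalIntegral.integral_hasDerivAt_right (hf.intervalIntegrable _ _)
      (hf.stronglyMeasurableAtFilter _ _) hf.continuousAt
  obtain ⟨z, hz, hz0⟩ := exists_hasDerivAt_eq_zero hab
    (fun u _ => (hd u).continuousAt.continuousWithinAt) (by simp [h]) (fun u _ => hd u)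
  exact ⟨z, hz.1, hz.2, hz0⟩

theorem linInterp_eq_zero_of_integrals {T : ℝ} (hT : 0 < T) {p : ℕ} {t : Fin (p + 1) → ℝ}
    (ht : StrictMono t) (ht_mem : ∀ j, t j ∈ Set.Icc 0 T) {L : ℕ} (hL : 0 < L)
    (hgap : ∀ j : Fin p, T / (t j.succ - t j.castSucc) < (L : ℝ)) {v : Fin (p + 1) → ℝ}
    (hv : ∀ i : Fin L, ∫ r in (T * (i : ℝ) / L)..(T * ((i : ℝ) + 1) / L), linInterp t v r = 0) :
    v = 0 := by
  have hL' : (0 : ℝ) < L := by exact_mod_cast hL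
  have hh : 0 < T / L := by positivity
  -- Indices are clamped at `p` so that knots and values become sequences on `ℕ`.
  set ι : ℕ → Fin (p + 1) := fun j => ⟨min j p, by omega⟩ with hι
  have hι0 : ι 0 = 0 := Fin.ext (by simp [hι])
  have hιp : ι p = Fin.last p := Fin.ext (by simp [hι])
  have hι1 : ∀ j (hj : j < p), ι j = (⟨j, hj⟩ : Fin p).castSucc := fun j hj =>
    Fin.ext (by simp [hι]; omega)
  have hι2 : ∀ j (hj : j < p), ι (j + 1) = (⟨j, hj⟩ : Fin p).succ := fun j hj =>
    Fin.ext (by simp [hι]; omega)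
  have hcont : Continuous (linInterp t v) :=
    (continuous_linInterp t).comp (Continuous.prodMk_right v)
  have key := eq_zero_of_zeros_in_cells (x := linInterp t v) (τ := fun j => t (ι j))
    (w := fun j => v (ι j)) (p := p) (L := L) hh hL
    (fun j hj => by
      simp only [hι1 j hj, hι2 j hj]
      have hpos : 0 < t (⟨j, hj⟩ : Fin p).succ - t (⟨j, hj⟩ : Fin p).castSucc :=
        sub_pos.2 (ht Fin.castSucc_lt_succ)
      have := hgap ⟨j, hj⟩
      rw [div_lt_iff₀ hpos] at this
      rw [div_lt_iff₀ hL']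
      linarith)
    (ht_mem _).1 (by rw [mul_div_cancel₀ _ hL'.ne']; exact (ht_mem _).2)
    (fun r hr => by simp only [hι0] at hr ⊢; exact linInterp_of_le ht v hr)
    (fun r hr => by simp only [hιp] at hr ⊢; exact linInterp_of_ge ht v hr)
    (fun j hj r hr hr' => by
      simp only [hι1 j hj, hι2 j hj] at hr hr' ⊢
      exact linInterp_of_mem ht v _ hr hr')
    (fun i hi => by
      obtain ⟨z, h1, h2, h3⟩ := exists_zero_of_integral_eq_zero hcont
        (by gcongr; linarith) (hv ⟨i, hi⟩)
      exact ⟨z, by rwa [mul_div_assoc', mul_comm], by rwa [mul_div_assoc', mul_comm], h3⟩)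
  ext j
  have := key j (by omega)
  have hj : ι j = j := Fin.ext (by simp [hι]; omega)
  simpa only [hj, Pi.zero_apply] using this

/-- The location coordinates determine the interpolated vector. -/
theorem injective_lsTransform {T : ℝ} (hT : 0 < T) {p : ℕ} {t : Fin (p + 1) → ℝ}
    (ht : StrictMono t) (ht_mem : ∀ j, t j ∈ Set.Icc 0 T) {L : ℕ} (S : ℕ) (hL : 0 < L)
    (hgap : ∀ j : Fin p, T / (t j.succ - t j.castSucc) < (L : ℝ)) :
    Function.Injective (lsTransform T t L S) := by
  intro v v' h
  have hcont : ∀ v, Continuous (linInterp t v) := fun v =>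
    (continuous_linInterp t).comp (Continuous.prodMk_right v)
  rw [← sub_eq_zero]
  refine linInterp_eq_zero_of_integrals hT ht ht_mem hL hgap fun i => ?_
  have hi := congrArg (fun y : EuclideanSpace ℝ (Fin L ⊕ Fin S) => y (Sum.inl i)) h
  simp only [lsTransform, Sum.elim_inl] at hi
  simp only [linInterp_sub]
  rw [intervalIntegral.integral_sub ((hcont v).intervalIntegrable _ _)
    ((hcont v').intervalIntegrable _ _), hi, sub_self]

/-! ### Transfer of optimality along a measurable embedding. -/

theorem measurable_intervalIntegral_param {α : Type*} [MeasurableSpace α] {f : α → ℝ → ℝ}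
    (hf : Measurable (Function.uncurry f)) (a b : ℝ) :
    Measurable fun v => ∫ r in a..b, f v r := by
  simp only [intervalIntegral]
  exact (hf.stronglyMeasurable.integral_prod_right.measurable).sub
    (hf.stronglyMeasurable.integral_prod_right.measurable)

theorem measurable_lsTransform (T : ℝ) {p : ℕ} (t : Fin (p + 1) → ℝ) (L S : ℕ) :
    Measurable (lsTransform T t L S) := by
  refine (WithLp.measurable_toLp 2 _).comp (measurable_pi_iff.2 fun i => ?_)
  rcases i with i | i
  · exact measurable_intervalIntegral_param (continuous_linInterp t).measurable _ _
  · exact measurable_intervalIntegral_param (f := fun v r => deriv (linInterp t v) r)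
      (measurable_deriv_with_param (continuous_linInterp t)) _ _

/-- For an embedding the image measure is given by preimages of arbitrary sets, so `g` need not be
measurable. -/
theorem risk_comp {X E : Type*} [MeasurableSpace X] [MeasurableSpace E] {φ : X → E}
    (hφ : MeasurableEmbedding φ) (π : Fin 2 → ℝ) (F : Fin 2 → Measure X) (g : E → Fin 2) :
    risk π F (fun v => g (φ v)) = risk π (fun c => (F c).map φ) g := by
  simp only [risk, Measure.real, hφ.map_apply]
  rfl

/-- Every measurable rule on `X` extends along the embedding to a measurable rule on `E`, so both
infima run over the same risks. -/
theorem bayesRisk_map {X E : Type*} [MeasurableSpace X] [MeasurableSpace E] {φ : X → E}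
    (hφ : MeasurableEmbedding φ) (π : Fin 2 → ℝ) (F : Fin 2 → Measure X) :
    bayesRisk π (fun c => (F c).map φ) = bayesRisk π F := by
  have hsurj : Function.Surjective (fun g : {g : E → Fin 2 // Measurable g} =>
      (⟨g.1 ∘ φ, g.2.comp hφ.measurable⟩ : {g : X → Fin 2 // Measurable g})) := by
    rintro ⟨g, hg⟩
    obtain ⟨g', hg', h⟩ := hφ.exists_measurable_extend hg fun _ => ⟨0⟩
    exact ⟨⟨g', hg'⟩, Subtype.ext h⟩
  unfold bayesRisk
  rw [← hsurj.iInf_comp]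
  exact iInf_congr fun g => (risk_comp hφ π F g.1).symm

theorem BayesOptimal.comp {Ω X E : Type*} [MeasurableSpace Ω] [MeasurableSpace X]
    [MeasurableSpace E] {P : Measure Ω} {φ : X → E} (hφ : MeasurableEmbedding φ) {π : Fin 2 → ℝ}
    {F : Fin 2 → Measure X} {g : ℕ → Ω → E → Fin 2}
    (h : BayesOptimal P π (fun c => (F c).map φ) g) :
    BayesOptimal P π F (fun N ω v => g N ω (φ v)) := by
  unfold BayesOptimal at h ⊢
  simpa only [risk_comp hφ, bayesRisk_map hφ] using h

theorem BayesOptimal.congr {Ω X : Type*} [MeasurableSpace Ω] [MeasurableSpace X] {P : Measure Ω}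
    {π : Fin 2 → ℝ} {F : Fin 2 → Measure X} {g g' : ℕ → Ω → X → Fin 2}
    (h : BayesOptimal P π F g) (hg : ∀ᵐ ω ∂P, ∀ N, g N ω = g' N ω) : BayesOptimal P π F g' :=
  TendstoInMeasure.congr (fun N => hg.mono fun ω hω => by simp only [hω N]) (EventuallyEq.refl _ _) h

/-- Universal consistency of the `k`-nearest-neighbour rule for embedded data. -/
theorem bayesOptimal_knnClassifier_comp {X E : Type*} [MeasurableSpace X] [MetricSpace E]
    [MeasurableSpace E] [BorelSpace E] [SecondCountableTopology E] [HasBesicovitchCovering E]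
    {φ : X → E} (hφ : MeasurableEmbedding φ) {Ω : Type*} [MeasurableSpace Ω] {P : Measure Ω}
    [IsProbabilityMeasure P] (F : Fin 2 → Measure X) [∀ c, IsProbabilityMeasure (F c)]
    {V : Fin 2 → ℕ → Ω → X} (hlaw : ∀ c i, HasLaw (V c i) (F c) P)
    (hind : iIndepFun (fun ci : Fin 2 × ℕ => V ci.1 ci.2) P)
    {π : Fin 2 → ℝ} (hπ : ∀ c, 0 ≤ π c) (hπ_sum : π 0 + π 1 = 1) {m n k : ℕ → ℕ}
    (hmn : Tendsto (fun N => m N + n N) atTop atTop)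
    (hprior : Tendsto (fun N => (n N : ℝ) / ((m N : ℝ) + (n N : ℝ))) atTop (𝓝 (π 1)))
    (hktop : Tendsto k atTop atTop)
    (hk : Tendsto (fun N => (k N : ℝ) / ((m N : ℝ) + (n N : ℝ))) atTop (𝓝 0)) :
    BayesOptimal P π F (fun N ω v => knnClassifier (fun i : Fin (m N) => φ (V 0 i ω))
      (fun i : Fin (n N) => φ (V 1 i ω)) (k N) (φ v)) := by
  obtain ⟨s, rfl, rfl⟩ : ∃ s : ℕ → Fin 2 → ℕ, m = (fun N => s N 0) ∧ n = fun N => s N 1 :=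
    ⟨fun N => ![m N, n N], by simp, by simp⟩
  have hφm := hφ.measurable
  have hprob : ∀ c, IsProbabilityMeasure ((F c).map φ) := fun c =>
    Measure.isProbabilityMeasure_map hφm.aemeasurable
  have hae : ∀ c i, AEMeasurable (V c i) P := fun c i => (hlaw c i).aemeasurable
  -- `HasLaw` gives only a.e. measurability. Measurable versions agree with the whole countable
  -- sample almost surely, so the risks agree almost surely for all `N` at once.
  obtain ⟨W, hWm, hW⟩ : ∃ W : Fin 2 → ℕ → Ω → X, (∀ c i, Measurable (W c i)) ∧
      ∀ c i, V c i =ᵐ[P] W c i :=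
    ⟨fun c i => (hae c i).mk (V c i), fun c i => (hae c i).measurable_mk,
      fun c i => (hae c i).ae_eq_mk⟩
  have hs : ∀ c, Tendsto (fun N => (s N c : ℝ) / (s N 0 + s N 1 : ℕ)) atTop (𝓝 (π c)) := by
    rw [Fin.forall_fin_two]
    refine ⟨?_, by simpa using hprior⟩
    have h := hprior.const_sub 1
    rw [← hπ_sum, add_sub_cancel_right, hπ_sum] at h
    refine h.congr' ?_
    filter_upwards [hmn.eventually_gt_atTop 0] with N hN
    have : (s N 0 : ℝ) + s N 1 ≠ 0 := by exact_mod_cast hN.ne'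
    simp only [Nat.cast_add]
    field_simp
    ring
  have hindW : iIndepFun (fun ci : Fin 2 × ℕ => W ci.1 ci.2) P :=
    hind.congr fun ci => hW ci.1 ci.2
  have hcons := bayesOptimal_knnClassifier (P := P) (fun c => (F c).map φ)
    (V := fun c i ω => φ (W c i ω)) (fun c i => hφm.comp (hWm c i))
    (hindW.comp _ fun _ => hφm)
    (fun c i => by
      rw [← (hlaw c i).map_eq, Measure.map_congr (hW c i), Measure.map_map hφm (hWm c i)]
      rfl)
    hπ (s := s) (M := fun N => s N 0 + s N 1) hmn hs hktop (by simpa using hk)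
  have hcomp := BayesOptimal.comp hφ hcons
  refine BayesOptimal.congr hcomp ?_
  have hall : ∀ᵐ ω ∂P, ∀ c i, V c i ω = W c i ω := ae_all_iff.2 fun c => ae_all_iff.2 (hW c)
  filter_upwards [hall] with ω hω N
  simp only [hω]

end LSkNN

theorem corollary3
    -- two processes with paths in the path space over `[0, T]`
    {Ω : Type*} [MeasurableSpace Ω] (P : Measure Ω) [IsProbabilityMeasure P]
    (T : ℝ) (hT : 0 < T)
    (G : Fin 2 → ℝ → Ω → ℝ)
    (hG_meas : ∀ c, ∀ s ∈ Set.Icc 0 T, Measurable (G c s))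
    (hG_path : ∀ c, ∀ᵐ ω ∂P, LSkNN.IsPath T (fun s => G c s ω))
    -- the discretization points
    {p : ℕ} (t : Fin (p + 1) → ℝ) (ht_mono : StrictMono t) (ht_mem : ∀ j, t j ∈ Set.Icc 0 T)
    -- the prior probabilities of the classes
    (π : Fin 2 → ℝ) (hπ_nonneg : ∀ c, 0 ≤ π c) (hπ_sum : π 0 + π 1 = 1)
    -- independent samples of vectors distributed as the marginals of the two processes
    {Ω' : Type*} [MeasurableSpace Ω'] (P' : Measure Ω') [IsProbabilityMeasure P']
    (V : Fin 2 → ℕ → Ω' → (Fin (p + 1) → ℝ))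
    (hV_law : ∀ c i, HasLaw (V c i) (LSkNN.marginal P (G c) t) P')
    (hV_indep : iIndepFun (fun ci : Fin 2 × ℕ => V ci.1 ci.2) P')
    -- sample sizes `m N`, `n N` of the classes `0`, `1` and numbers `k N` of neighbours
    (m n k : ℕ → ℕ)
    (hmn : Tendsto (fun N => m N + n N) atTop atTop)
    (hprior : Tendsto (fun N => (n N : ℝ) / ((m N : ℝ) + (n N : ℝ))) atTop (𝓝 (π 1)))
    (hk : Tendsto k atTop atTop)
    (hk_small : Tendsto (fun N => (k N : ℝ) / ((m N : ℝ) + (n N : ℝ))) atTop (𝓝 0))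
    -- the dimensions of the location-slope space
    (L S : ℕ) (hL_pos : 0 < L)
    (hL : ∀ j : Fin p, T / (t j.succ - t j.castSucc) < (L : ℝ)) :
    LSkNN.BayesOptimal P' π (fun c => LSkNN.marginal P (G c) t)
      (fun N ω v => LSkNN.knnClassifier
        (fun i : Fin (m N) => LSkNN.lsTransform T t L S (V 0 i ω))
        (fun i : Fin (n N) => LSkNN.lsTransform T t L S (V 1 i ω))
        (k N) (LSkNN.lsTransform T t L S v)) := by
  -- By the Lusin–Souslin theorem, an injective measurable map between standard Borel spaces is a
  -- measurable embedding. The slope coordinates need only be measurable, since injectivity comes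
  -- from the location coordinates.
  have hφ : MeasurableEmbedding (LSkNN.lsTransform T t L S) :=
    (LSkNN.measurable_lsTransform T t L S).measurableEmbedding
      (LSkNN.injective_lsTransform hT ht_mono ht_mem S hL_pos hL)
  have hprob : ∀ c, IsProbabilityMeasure (LSkNN.marginal P (G c) t) := fun c =>
    Measure.isProbabilityMeasure_map
      (measurable_pi_iff.2 fun j => hG_meas c (t j) (ht_mem j)).aemeasurable
  exact LSkNN.bayesOptimal_knnClassifier_comp hφ (fun c => LSkNN.marginal P (G c) t) hV_law
    hV_indep hπ_nonneg hπ_sum hmn hprior hk hk_small
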